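/- Let $S^1=\mathbb{R}/2\pi\mathbb{Z}$ and let $f\colon S^1\to\mathbb{R}$ be smooth. Put $c(t)=(f(t),f'(t))\in\mathbb{R}^2$ and $C(t)=(f(t),f'(t),f''(t))\in\mathbb{R}^3$, with linear coordinates $(x_0,x_1)$ and $(x_0,x_1,x_2)$. If $C$ is an embedding and $c$ is an immersion, then $C$ is called a framed holonomic knot. Its Whitney index $W(C)\in\mathbb{Z}$ is the tangential degree of the closed plane curve $c$, that is, the number of turns, counted with respect to the orientation $dx_0\wedge dx_1$, of the tangent vector $c'(t)$ as $t$ goes once around $S^1$. Its self-linking number $S(C)\in\mathbb{Z}$ is the linking number, with respect to the orientation $dx_0\wedge dx_1\wedge dx_2$ of $\mathbb{R}^3$, of $C$ and the shifted copy $C+\varepsilon\,\partial_{x_2}$ for all sufficiently small $\varepsilon>0$. **Proposition 1.1.** (a) Every framed holonomic knot $C$ satisfies $W(C)<0$. (b) If $C$ is a framed holonomic knot with $W(C)=-1$, then $S(C)=0$ and $C$ represents the unknot. (c) For all integers $m\le -2$ and $n$ such that $m+n$ is odd, there exists a framed holonomic knot $C$ with $W(C)=m$ and $S(C)=n$. 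-/

import Mathlib

open Real Filter Topology
open scoped ContDiff

/-! The circle is `ℝ / 2πℤ`; a map on the circle is a `2π`-periodic map on `ℝ`. -/

/-- The 1-jet extension `(f, f')` of a function on the circle. -/
noncomputable def holonomicPlaneCurve (f : ℝ → ℝ) (t : ℝ) : Fin 2 → ℝ :=
  ![f t, deriv f t]

/-- The 2-jet extension `(f, f', f'')` of a function on the circle. -/
noncomputable def holonomicSpaceCurve (f : ℝ → ℝ) (t : ℝ) : Fin 3 → ℝ :=
  ![f t, deriv f t, deriv (deriv f) t]

/-- A (parametrized) smooth knot in 3-space: a smooth embedding of the circle, that is,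
a smooth injective immersion. -/
structure IsSmoothKnot (γ : ℝ → Fin 3 → ℝ) : Prop where
  smooth : ContDiff ℝ ∞ γ
  periodic : Function.Periodic γ (2 * π)
  injective : Set.InjOn γ (Set.Ico 0 (2 * π))
  immersion : ∀ t, deriv γ t ≠ 0

/-- The smooth function `f` on the circle gives rise to a framed holonomic knot:
its 2-jet extension is an embedding and its 1-jet extension is an immersion. -/
structure IsFramedHolonomicKnot (f : ℝ → ℝ) : Prop where
  smooth : ContDiff ℝ ∞ f
  periodic : Function.Periodic f (2 * π)
  knot : IsSmoothKnot (holonomicSpaceCurve f)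
  immersion : ∀ t, deriv (holonomicPlaneCurve f) t ≠ 0

/-- The tangent vector of the closed plane curve `c` turns `m` times, counterclockwise with
respect to the orientation `dx₀ ∧ dx₁`, as the circle is traversed once: some continuous
choice `θ` of the angle of the tangent vector increases by `2πm`. -/
def HasTangentialDegree (c : ℝ → Fin 2 → ℝ) (m : ℤ) : Prop :=
  ∃ θ : ℝ → ℝ, Continuous θ ∧
    (∀ t, ∃ r : ℝ, 0 < r ∧ deriv c t = r • ![cos (θ t), sin (θ t)]) ∧
    θ (2 * π) - θ 0 = 2 * π * m

/-- The Whitney index `W`: the tangential degree of the projection of the curve along the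
`x₂`-axis. For an immersed closed curve there is exactly one such integer. -/
noncomputable def whitneyIndex (f : ℝ → ℝ) : ℤ :=
  Classical.epsilon (HasTangentialDegree (holonomicPlaneCurve f))

/-- The determinant of three vectors with respect to the orientation `dx₀ ∧ dx₁ ∧ dx₂`. -/
noncomputable def det3 (a b c : Fin 3 → ℝ) : ℝ :=
  Matrix.det (Matrix.of ![a, b, c])

/-- The parameter pairs `(s, t)` at which `γ` passes over `η`, seen from the direction `v`
(the point `γ s` lies on the open ray issuing from `η t` in direction `v`). -/
def overcrossings (γ η : ℝ → Fin 3 → ℝ) (v : Fin 3 → ℝ) : Set (ℝ × ℝ) :=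
  {p | p.1 ∈ Set.Ico 0 (2 * π) ∧ p.2 ∈ Set.Ico 0 (2 * π) ∧
    ∃ r : ℝ, 0 < r ∧ γ p.1 - η p.2 = r • v}

/-- The determinant whose sign is the sign of the crossing at `(s, t)`. If `γ` passes over `η`
there, seen from `e₂`, this is a positive multiple of the plane determinant of the projected
tangent vectors of the over- and the under-strand, in this order. -/
noncomputable def crossingDet (γ η : ℝ → Fin 3 → ℝ) (p : ℝ × ℝ) : ℝ :=
  det3 (deriv γ p.1) (deriv η p.2) (γ p.1 - η p.2)

/-- The linking number of the disjoint smooth closed curves `γ` and `η` is `n`: for a direction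
`v` such that all crossings at which `γ` passes over `η` are transverse in the projection along
`v`, the signs of these crossings add up to `n`. In other words `v` is a regular value of
`(s, t) ↦ (γ s - η t) / |γ s - η t|`, a map from the torus to the sphere, and `n` is the degree
of this map computed at `v`. Regular directions are of full measure, and they all give
the same `n`. -/
def HasLinkingNumber (γ η : ℝ → Fin 3 → ℝ) (n : ℤ) : Prop :=
  (∀ s t, γ s ≠ η t) ∧
  ∃ v : Fin 3 → ℝ, v ≠ 0 ∧ (overcrossings γ η v).Finite ∧
    (∀ p ∈ overcrossings γ η v, crossingDet γ η p ≠ 0) ∧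
    ∑ᶠ p ∈ overcrossings γ η v, (SignType.sign (crossingDet γ η p) : ℤ) = n

/-- The self linking number `S` of the framed holonomic knot of `f` is `n`: the knot and its
copy shifted slightly in the projection direction `∂_{x₂}` have linking number `n`. -/
def HasSelfLinkingNumber (f : ℝ → ℝ) (n : ℤ) : Prop :=
  ∀ᶠ ε in 𝓝[>] (0 : ℝ),
    HasLinkingNumber (holonomicSpaceCurve f)
      (fun t => holonomicSpaceCurve f t + ![0, 0, ε]) n

/-- Two knots are isotopic: they are joined by a smooth one-parameter family of smooth
embeddings of the circle (equivalently, they are ambient isotopic). -/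
def KnotIsotopic (γ η : ℝ → Fin 3 → ℝ) : Prop :=
  ∃ H : ℝ → ℝ → Fin 3 → ℝ, ContDiff ℝ ∞ (fun p : ℝ × ℝ => H p.1 p.2) ∧
    (∀ u ∈ Set.Icc (0 : ℝ) 1, IsSmoothKnot (H u)) ∧ H 0 = γ ∧ H 1 = η

/-- The knot represents the unknot: it is isotopic to the round planar circle. -/
def IsUnknot (γ : ℝ → Fin 3 → ℝ) : Prop :=
  KnotIsotopic γ (fun t => ![cos t, sin t, 0])

/-! ### Jets of smooth functions -/

/-! The tangent vector of c is (f', f''), so where it is vertical, f' = 0, its angle θ has numerator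
f' f''' - (f'')² = -(f'')² < 0: θ crosses every level nπ + π/2 downwards only
(`lt_of_le_of_hasDerivAt_neg`). Since f' vanishes somewhere by Rolle, θ lies strictly lower one
period later, whence W < 0.

If W = -1, then θ drops by exactly 2π per period and so meets only two vertical directions. Hence f'
has just two zeros on the circle, with f decreasing and f' < 0 on one arc, f increasing and f' > 0
on the other (`IsFramedHolonomicKnot.exists_extrema`). The two arcs of c lie in opposite half planes
and each is a graph over the x₀-axis, so c is embedded. There are then no crossings, and S = 0.
After a reparametrization, these sign conditions are convex in the curve, so linear interpolation is
an isotopy to a round circle (`isUnknot_of_unimodal`).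

For the realization, S is read off from c: looking along ∂_{x₂}, each transverse double point gives
a single overcrossing, of sign -sign f' (`hasSelfLinkingNumber_of_doublePoints`). Curves c are built
as polar graphs winding k = K + 1 times clockwise around the origin, whose log-radius is a small
multiple of a function M on the k-fold cover of ℝ/ℤ. Such a graph becomes holonomic, up to scaling
x₁, if it is traversed at the right speed; this works smoothly across the x₀-axis because M is
composed with a coordinate whose derivative is sin²/π (`exists_framedHolonomicKnot_of_sheets`). Then
W = -k, and double points are coincidences of values of M on different sheets.

The function M of `exists_sheets` has K double points with f' < 0, contributing +K, and 2r further
ones over a quarter circle that may be put on either side of the x₀-axis, contributing ±2r. Thus W =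
-(K + 1) and S = K ± 2r, which are all pairs of the required parity. -/

theorem contDiff_deriv {f : ℝ → ℝ} (hf : ContDiff ℝ ∞ f) : ContDiff ℝ ∞ (deriv f) :=
  (contDiff_infty_iff_deriv.1 hf).2

theorem ContDiff.hasDerivAt_deriv {f : ℝ → ℝ} (hf : ContDiff ℝ ∞ f) (t : ℝ) :
    HasDerivAt f (deriv f t) t :=
  ((contDiff_infty_iff_deriv.1 hf).1 t).hasDerivAt

theorem periodic_deriv {f : ℝ → ℝ} {T : ℝ} (hp : Function.Periodic f T) :
    Function.Periodic (deriv f) T := fun t => by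
  rw [← deriv_comp_add_const f T t]
  exact congrArg (deriv · t) (funext hp)

theorem deriv_holonomicPlaneCurve {f : ℝ → ℝ} (hf : ContDiff ℝ ∞ f) (t : ℝ) :
    deriv (holonomicPlaneCurve f) t = ![deriv f t, deriv (deriv f) t] := by
  refine (hasDerivAt_pi.2 fun i => ?_).deriv
  fin_cases i
  · exact hf.hasDerivAt_deriv t
  · exact (contDiff_deriv hf).hasDerivAt_deriv t

theorem deriv_vec3 {x y z : ℝ → ℝ} (hx : ContDiff ℝ ∞ x) (hy : ContDiff ℝ ∞ y)
    (hz : ContDiff ℝ ∞ z) (t : ℝ) :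
    deriv (fun t => ![x t, y t, z t]) t = ![deriv x t, deriv y t, deriv z t] := by
  refine (hasDerivAt_pi.2 fun i => ?_).deriv
  fin_cases i
  · exact hx.hasDerivAt_deriv t
  · exact hy.hasDerivAt_deriv t
  · exact hz.hasDerivAt_deriv t

theorem contDiff_vec3 {E : Type*} [NormedAddCommGroup E] [NormedSpace ℝ E] {x y z : E → ℝ}
    (hx : ContDiff ℝ ∞ x) (hy : ContDiff ℝ ∞ y) (hz : ContDiff ℝ ∞ z) :
    ContDiff ℝ ∞ fun t => ![x t, y t, z t] := by
  refine contDiff_pi.2 fun i => ?_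
  fin_cases i
  · exact hx
  · exact hy
  · exact hz

theorem deriv_holonomicSpaceCurve {f : ℝ → ℝ} (hf : ContDiff ℝ ∞ f) (t : ℝ) :
    deriv (holonomicSpaceCurve f) t =
      ![deriv f t, deriv (deriv f) t, deriv (deriv (deriv f)) t] :=
  deriv_vec3 hf (contDiff_deriv hf) (contDiff_deriv (contDiff_deriv hf)) t

theorem jet_ne_zero {f : ℝ → ℝ} (hf : IsFramedHolonomicKnot f) (t : ℝ)
    (h : deriv f t = 0) : deriv (deriv f) t ≠ 0 := fun h' => by
  refine hf.immersion t ?_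
  rw [deriv_holonomicPlaneCurve hf.smooth, h, h']
  ext i
  fin_cases i <;> rfl

theorem holonomicPlaneCurve_eq_iff {f : ℝ → ℝ} {s t : ℝ} :
    holonomicPlaneCurve f s = holonomicPlaneCurve f t ↔
      f s = f t ∧ deriv f s = deriv f t := by
  simp [holonomicPlaneCurve, funext_iff, Fin.forall_fin_two]

theorem holonomicSpaceCurve_eq_iff {f : ℝ → ℝ} {s t : ℝ} :
    holonomicSpaceCurve f s = holonomicSpaceCurve f t ↔
      f s = f t ∧ deriv f s = deriv f t ∧ deriv (deriv f) s = deriv (deriv f) t := by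
  simp [holonomicSpaceCurve, funext_iff, Fin.forall_fin_succ]

/-- The immersion condition on the plane curve already makes the space curve immersed, as its first
two components do not both have zero derivative. -/
theorem framedHolonomicKnot_of_jets {f : ℝ → ℝ} (hf : ContDiff ℝ ∞ f)
    (hp : Function.Periodic f (2 * π)) (h0 : ∀ t, deriv f t = 0 → deriv (deriv f) t ≠ 0)
    (hinj : ∀ s ∈ Set.Ico 0 (2 * π), ∀ t ∈ Set.Ico 0 (2 * π), f s = f t →
      deriv f s = deriv f t → deriv (deriv f) s = deriv (deriv f) t → s = t) :
    IsFramedHolonomicKnot f where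
  smooth := hf
  periodic := hp
  knot :=
    { smooth := contDiff_vec3 hf (contDiff_deriv hf) (contDiff_deriv (contDiff_deriv hf))
      periodic := fun t => holonomicSpaceCurve_eq_iff.2
        ⟨hp t, periodic_deriv hp t, periodic_deriv (periodic_deriv hp) t⟩
      injective := fun s hs t ht h => by
        obtain ⟨h1, h2, h3⟩ := holonomicSpaceCurve_eq_iff.1 h
        exact hinj s hs t ht h1 h2 h3
      immersion := fun t h => by
        rw [deriv_holonomicSpaceCurve hf] at h
        exact h0 t (congrFun h 0) (congrFun h 1) }
  immersion := fun t h => by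
    rw [deriv_holonomicPlaneCurve hf] at h
    exact h0 t (congrFun h 0) (congrFun h 1)

/-! ### The tangential degree -/

/-- A continuous real function with values in `2πℤ` is constant. -/
theorem eq_of_continuous_of_cos_eq_one {g : ℝ → ℝ} (hg : Continuous g)
    (h : ∀ t, cos (g t) = 1) (s t : ℝ) : g s = g t := by
  have hm : ∀ x, ∃ n : ℤ, (n : ℝ) = g x / (2 * π) := fun x => by
    obtain ⟨n, hn⟩ := (cos_eq_one_iff _).1 (h x)
    exact ⟨n, by rw [← hn]; field_simp⟩
  choose n hn using hm
  have hc : Continuous n := by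
    rw [Int.isClosedEmbedding_coe_real.isInducing.continuous_iff]
    have : ((↑) : ℤ → ℝ) ∘ n = fun x => g x / (2 * π) := funext hn
    rw [this]
    exact hg.div_const _
  have h1 := hn s
  rw [PreconnectedSpace.constant inferInstance hc (x := s) (y := t), hn t] at h1
  field_simp at h1
  exact h1.symm

theorem polar_angle_unique {r r' a b : ℝ} (hr : 0 < r) (hr' : 0 < r')
    (hc : r * cos a = r' * cos b) (hs : r * sin a = r' * sin b) : cos (a - b) = 1 := by
  have hrr : r = r' := by
    have : r ^ 2 = r' ^ 2 := by
      calc r ^ 2 = (r * cos a) ^ 2 + (r * sin a) ^ 2 := by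
            linear_combination -r ^ 2 * sin_sq_add_cos_sq a
        _ = r' ^ 2 := by
            rw [hc, hs]
            linear_combination r' ^ 2 * sin_sq_add_cos_sq b
    exact (sq_eq_sq₀ hr.le hr'.le).1 this
  subst hrr
  rw [cos_sub, mul_left_cancel₀ hr.ne' hc, mul_left_cancel₀ hr.ne' hs]
  linear_combination sin_sq_add_cos_sq b

/-- Two angle functions for the same tangent vector differ by a continuous function with values in
2πℤ, hence by a constant. This is what gives the choice in `whitneyIndex` a definite value. -/
theorem HasTangentialDegree.unique {c : ℝ → Fin 2 → ℝ} {m m' : ℤ}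
    (h : HasTangentialDegree c m) (h' : HasTangentialDegree c m') : m = m' := by
  obtain ⟨θ, hθ, hr, hm⟩ := h
  obtain ⟨θ', hθ', hr', hm'⟩ := h'
  have key := eq_of_continuous_of_cos_eq_one (hθ.sub hθ') (fun t => by
    obtain ⟨r, r0, hr⟩ := hr t
    obtain ⟨r', r0', hr'⟩ := hr' t
    rw [hr] at hr'
    have e0 : r * cos (θ t) = r' * cos (θ' t) := congrFun hr' 0
    have e1 : r * sin (θ t) = r' * sin (θ' t) := congrFun hr' 1
    exact polar_angle_unique r0 r0' e0 e1) (2 * π) 0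
  have : (2 * π) * (m : ℝ) = 2 * π * m' := by
    simp only [Pi.sub_apply] at key
    rw [← hm, ← hm']; linarith
  exact_mod_cast mul_left_cancel₀ two_pi_pos.ne' this

theorem whitneyIndex_eq {f : ℝ → ℝ} {m : ℤ}
    (h : HasTangentialDegree (holonomicPlaneCurve f) m) : whitneyIndex f = m :=
  (Classical.epsilon_spec (p := HasTangentialDegree (holonomicPlaneCurve f)) ⟨m, h⟩).unique h

/-- A nowhere vanishing `C¹` curve in the plane has a differentiable angle function. -/
theorem exists_angle {x y x' y' : ℝ → ℝ} (hx : ∀ t, HasDerivAt x (x' t) t)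
    (hy : ∀ t, HasDerivAt y (y' t) t) (hx' : Continuous x') (hy' : Continuous y')
    (h0 : ∀ t, x t = 0 → y t ≠ 0) :
    ∃ θ : ℝ → ℝ, (∀ t, HasDerivAt θ ((x t * y' t - y t * x' t) / (x t ^ 2 + y t ^ 2)) t) ∧
      ∀ t, ∃ r : ℝ, 0 < r ∧ x t = r * cos (θ t) ∧ y t = r * sin (θ t) := by
  let z : ℝ → ℂ := fun t => x t + y t * Complex.I
  let z' : ℝ → ℂ := fun t => x' t + y' t * Complex.I
  have hz : ∀ t, HasDerivAt z (z' t) t := fun t =>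
    (hx t).ofReal_comp.add ((hy t).ofReal_comp.mul_const _)
  have hz0 : ∀ t, z t ≠ 0 := fun t h => by
    have hre := congrArg Complex.re h
    have him := congrArg Complex.im h
    simp [z] at hre him
    exact h0 t hre him
  have hzc : Continuous z := continuous_iff_continuousAt.2 fun t => (hz t).continuousAt
  have hzc' : Continuous z' := by fun_prop
  have hq : Continuous fun t => z' t / z t := hzc'.div hzc hz0
  -- The primitive of z'/z is a logarithm of z/z(0); its imaginary part is the angle gained since
  -- time 0.
  let I : ℝ → ℂ := fun t => ∫ s in (0 : ℝ)..t, z' s / z s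
  have hI : ∀ t, HasDerivAt I (z' t / z t) t := fun t => hq.integral_hasStrictDerivAt 0 t |>.hasDerivAt
  have hconst : ∀ t, z t * Complex.exp (-I t) = z 0 := fun t => by
    have hd : ∀ t, HasDerivAt (fun t => z t * Complex.exp (-I t)) 0 t := fun t => by
      have := (hz t).mul ((hI t).neg.cexp)
      convert! this using 1
      field_simp [hz0 t]
      ring
    have := is_const_of_deriv_eq_zero (fun t => (hd t).differentiableAt)
      (fun t => (hd t).deriv) t 0
    simpa [I] using this
  refine ⟨fun t => Complex.arg (z 0) + (I t).im, fun t => ?_, fun t => ?_⟩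
  · have h1 : HasDerivAt (fun t => (I t).im) (z' t / z t).im t :=
      (Complex.imCLM.hasFDerivAt.comp_hasDerivAt t (hI t))
    refine (h1.const_add _).congr_deriv ?_
    rw [Complex.div_im]
    have : Complex.normSq (z t) = x t ^ 2 + y t ^ 2 := by simp [z, Complex.normSq_apply, sq]
    rw [this]
    simp [z, z']
    ring
  · have hzt : z t = (‖z 0‖ * Real.exp (I t).re : ℝ) *
        Complex.exp ((Complex.arg (z 0) + (I t).im : ℝ) * Complex.I) := by
      have e1 : z t = z 0 * Complex.exp (I t) := by
        rw [← hconst t, mul_assoc, ← Complex.exp_add]; simp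
      rw [e1]
      conv_lhs => rw [← Complex.norm_mul_exp_arg_mul_I (z 0), ← Complex.re_add_im (I t)]
      push_cast
      rw [mul_assoc, mul_assoc, ← Complex.exp_add, ← Complex.exp_add]
      ring_nf
    refine ⟨‖z 0‖ * Real.exp (I t).re, by have := hz0 0; positivity, ?_, ?_⟩
    · have := congrArg Complex.re hzt
      rw [Complex.re_ofReal_mul, Complex.exp_ofReal_mul_I_re] at this
      simpa [z] using this
    · have := congrArg Complex.im hzt
      rw [Complex.im_ofReal_mul, Complex.exp_ofReal_mul_I_im] at this
      simpa [z] using this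

/-- A function which decreases wherever it takes the value `α` takes it downwards only. -/
theorem lt_of_le_of_hasDerivAt_neg {θ θ' : ℝ → ℝ} (hθ : ∀ t, HasDerivAt θ (θ' t) t) {α : ℝ}
    (hα : ∀ t, θ t = α → θ' t < 0) {s t : ℝ} (hst : s < t) (hs : θ s ≤ α) : θ t < α := by
  have hc : Continuous θ := continuous_iff_continuousAt.2 fun t => (hθ t).continuousAt
  have hle : ∀ ⦃x⦄, x ∈ Set.Icc s t → θ x ≤ α :=
    image_le_of_deriv_right_lt_deriv_boundary (B := fun _ => α) (B' := fun _ => 0)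
      hc.continuousOn (fun x _ => (hθ x).hasDerivWithinAt) hs
      (fun x => hasDerivAt_const x α) (fun x _ h => hα x h)
  refine lt_of_le_of_ne (hle ⟨hst.le, le_rfl⟩) fun h => ?_
  -- If θ t = α, the negative derivative makes θ exceed α just before t, contrary to `hle`.
  have hslope := (hasDerivAt_iff_tendsto_slope.1 (hθ t)).eventually_lt_const (hα t h)
  have hleft : ∀ᶠ x in 𝓝[<] t, slope θ t x < 0 :=
    hslope.filter_mono (nhdsWithin_mono _ fun x hx => ne_of_lt hx)
  obtain ⟨x, hx, hxs⟩ := (hleft.and (Ioo_mem_nhdsLT hst)).exists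
  rw [slope_def_field, div_neg_iff] at hx
  have := hle ⟨hxs.1.le, hxs.2.le⟩
  have := hxs.2
  rcases hx with hx | hx <;> linarith [hx.1, hx.2]

/-- The angle of the tangent vector of the 1-jet of `f`: it turns clockwise whenever the tangent
vector is vertical. -/
theorem IsFramedHolonomicKnot.exists_angle {f : ℝ → ℝ} (hf : IsFramedHolonomicKnot f) :
    ∃ θ : ℝ → ℝ, Continuous θ ∧
      (∀ t, ∃ r : ℝ, 0 < r ∧ deriv f t = r * cos (θ t) ∧ deriv (deriv f) t = r * sin (θ t)) ∧
      (∀ (n : ℤ) (s t : ℝ), s < t → θ s ≤ n * π + π / 2 → θ t < n * π + π / 2) ∧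
      ∀ t, θ (t + 2 * π) = θ t + 2 * π * whitneyIndex f := by
  have h1 := contDiff_deriv hf.smooth
  have h2 := contDiff_deriv h1
  obtain ⟨θ, hθ, hr⟩ := _root_.exists_angle h1.hasDerivAt_deriv h2.hasDerivAt_deriv
    h2.continuous (contDiff_deriv h2).continuous (jet_ne_zero hf)
  have hc : Continuous θ := continuous_iff_continuousAt.2 fun t => (hθ t).continuousAt
  have hcos : ∀ t, cos (θ (t + 2 * π) - θ t) = 1 := fun t => by
    obtain ⟨r, r0, hx, hy⟩ := hr t
    obtain ⟨r', r0', hx', hy'⟩ := hr (t + 2 * π)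
    rw [periodic_deriv hf.periodic t, hx] at hx'
    rw [periodic_deriv (periodic_deriv hf.periodic) t, hy] at hy'
    exact polar_angle_unique r0' r0 hx'.symm hy'.symm
  have hshift : ∀ s t, (fun t => θ (t + 2 * π) - θ t) s = (fun t => θ (t + 2 * π) - θ t) t :=
    eq_of_continuous_of_cos_eq_one (by fun_prop) hcos
  obtain ⟨m, hm⟩ : ∃ m : ℤ, θ (2 * π) - θ 0 = 2 * π * m := by
    obtain ⟨m, hm⟩ := (cos_eq_one_iff _).1 (hcos 0)
    exact ⟨m, by rw [zero_add] at hm; rw [← hm]; ring⟩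
  have hW : whitneyIndex f = m := whitneyIndex_eq ⟨θ, hc, fun t => by
    obtain ⟨r, r0, hx, hy⟩ := hr t
    refine ⟨r, r0, ?_⟩
    rw [deriv_holonomicPlaneCurve hf.smooth, hx, hy]
    ext i
    fin_cases i <;> rfl, hm⟩
  refine ⟨θ, hc, hr, fun n s t hst hs => ?_, fun t => ?_⟩
  -- At a vertical tangent f' = 0, and the numerator f' f''' - f'' f'' of θ' reduces to -(f'')². The
  -- sign comes from the curve being holonomic: the x-velocity f' has derivative f''.
  · refine lt_of_le_of_hasDerivAt_neg hθ (fun t ht => ?_) hst hs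
    have h0 : deriv f t = 0 := by
      obtain ⟨r, r0, hx, -⟩ := hr t
      rw [hx, ht, cos_add_pi_div_two, sin_int_mul_pi, neg_zero, mul_zero]
    have := jet_ne_zero hf t h0
    rw [h0]
    have : 0 < deriv (deriv f) t ^ 2 := by positivity
    exact div_neg_of_neg_of_pos (by nlinarith) (by positivity)
  · rw [hW, ← hm]
    have := hshift t 0
    simp only [zero_add] at this
    linarith

theorem IsFramedHolonomicKnot.whitneyIndex_neg {f : ℝ → ℝ} (hf : IsFramedHolonomicKnot f) :
    whitneyIndex f < 0 := by
  obtain ⟨θ, -, hr, hdown, hper⟩ := hf.exists_angle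
  obtain ⟨t, -, ht⟩ := exists_deriv_eq_zero (f := f) two_pi_pos hf.smooth.continuous.continuousOn
    (by simpa using (hf.periodic 0).symm)
  obtain ⟨r, r0, hx, -⟩ := hr t
  have hcos : cos (θ t) = 0 := by
    rw [ht] at hx
    exact (mul_eq_zero.1 hx.symm).resolve_left r0.ne'
  obtain ⟨n, hn⟩ := cos_eq_zero_iff.1 hcos
  have hn' : θ t = n * π + π / 2 := by rw [hn]; ring
  have := hdown n t (t + 2 * π) (by linarith [two_pi_pos]) hn'.le
  rw [hper, ← hn'] at this
  have h2 : (2 * π) * (whitneyIndex f : ℝ) < (2 * π) * 0 := by linarith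
  exact_mod_cast lt_of_mul_lt_mul_left h2 two_pi_pos.le

/-! ### The self linking number from the double points of the plane projection -/

theorem holonomicSpaceCurve_sub_eq_smul_iff {f : ℝ → ℝ} {s t ε r : ℝ} :
    holonomicSpaceCurve f s - (holonomicSpaceCurve f t + ![0, 0, ε]) = r • ![(0 : ℝ), 0, 1] ↔
      holonomicPlaneCurve f s = holonomicPlaneCurve f t ∧
        deriv (deriv f) s - deriv (deriv f) t - ε = r := by
  rw [holonomicPlaneCurve_eq_iff]
  simp [holonomicSpaceCurve, funext_iff, Fin.forall_fin_succ, sub_eq_zero, sub_sub, and_assoc]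

/-- The third row of the determinant is r ∂_{x₂}, which leaves r times the plane determinant of (f',
f'') at s and at t; the two values of f' agree at a double point. -/
theorem crossingDet_shift {f : ℝ → ℝ} (hf : ContDiff ℝ ∞ f) {s t ε r : ℝ}
    (h : holonomicSpaceCurve f s - (holonomicSpaceCurve f t + ![0, 0, ε]) =
      r • ![(0 : ℝ), 0, 1]) :
    crossingDet (holonomicSpaceCurve f) (fun t => holonomicSpaceCurve f t + ![0, 0, ε]) (s, t) =
      r * (deriv f s * (deriv (deriv f) t - deriv (deriv f) s)) := by
  have hd := (holonomicPlaneCurve_eq_iff.1 (holonomicSpaceCurve_sub_eq_smul_iff.1 h).1).2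
  have h1 : deriv (fun t => holonomicSpaceCurve f t + ![0, 0, ε]) t =
      deriv (holonomicSpaceCurve f) t := deriv_add_const _
  simp only [crossingDet, h, h1, deriv_holonomicSpaceCurve hf, det3, Matrix.det_fin_three]
  simp [hd]
  ring

/-- For ε smaller than every height gap |f''(s i) - f''(t i)|, the shift does not change which
strand is on top, so each double point is seen exactly once from the vertical direction. The
over-strand has the larger f'', so by `crossingDet_shift` the sign is -sign f', whichever of the two
strands it is. The trivial pairs s = t do not count, as there the shifted copy lies above. -/
theorem hasSelfLinkingNumber_of_doublePoints {f : ℝ → ℝ} (hf : IsFramedHolonomicKnot f)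
    {ι : Type*} [Finite ι] (s t : ι → ℝ) (hs : ∀ i, s i ∈ Set.Ico 0 (2 * π))
    (ht : ∀ i, t i ∈ Set.Ico 0 (2 * π)) (hst : ∀ i j, s i ≠ t j) (hinj : Function.Injective s)
    (hdouble : ∀ i, holonomicPlaneCurve f (s i) = holonomicPlaneCurve f (t i))
    (hall : ∀ a ∈ Set.Ico 0 (2 * π), ∀ b ∈ Set.Ico 0 (2 * π), a ≠ b →
      holonomicPlaneCurve f a = holonomicPlaneCurve f b →
      ∃ i, (a = s i ∧ b = t i) ∨ (a = t i ∧ b = s i))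
    (hne : ∀ i, deriv f (s i) ≠ 0) :
    HasSelfLinkingNumber f (∑ᶠ i, -(SignType.sign (deriv f (s i)) : ℤ)) := by
  set f2 := deriv (deriv f) with hf2
  have hgap : ∀ i, 0 < |f2 (s i) - f2 (t i)| := fun i => by
    refine abs_pos.2 (sub_ne_zero.2 fun h => hst i i ?_)
    obtain ⟨h1, h2⟩ := holonomicPlaneCurve_eq_iff.1 (hdouble i)
    exact hf.knot.injective (hs i) (ht i) (holonomicSpaceCurve_eq_iff.2 ⟨h1, h2, h⟩)
  have hsmall : ∀ᶠ ε in 𝓝[>] (0 : ℝ), ∀ i, ε < |f2 (s i) - f2 (t i)| :=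
    eventually_all.2 fun i => (eventually_lt_nhds (hgap i)).filter_mono nhdsWithin_le_nhds
  filter_upwards [hsmall, self_mem_nhdsWithin] with ε hε hpos
  have hpos : 0 < ε := hpos
  -- The pair is ordered with the over-strand, the one with larger second derivative, first.
  let o : ι → ℝ × ℝ := fun i => if f2 (t i) < f2 (s i) then (s i, t i) else (t i, s i)
  have ho : Function.Injective o := fun i j hij => by
    simp only [o] at hij
    split_ifs at hij
    · exact hinj (Prod.ext_iff.1 hij).1
    · exact (hst i j (Prod.ext_iff.1 hij).1).elim
    · exact (hst j i (Prod.ext_iff.1 hij).1.symm).elim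
    · exact hinj (Prod.ext_iff.1 hij).2
  have hover : ∀ i, ∃ r : ℝ, 0 < r ∧ holonomicSpaceCurve f (o i).1 -
      (holonomicSpaceCurve f (o i).2 + ![0, 0, ε]) = r • ![(0 : ℝ), 0, 1] := fun i => by
    have := hε i
    by_cases h : f2 (t i) < f2 (s i)
    · rw [abs_of_pos (by linarith)] at this
      simp only [o, if_pos h]
      exact ⟨f2 (s i) - f2 (t i) - ε, by linarith,
        holonomicSpaceCurve_sub_eq_smul_iff.2 ⟨hdouble i, rfl⟩⟩
    · rw [abs_of_nonpos (by linarith)] at this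
      simp only [o, if_neg h]
      exact ⟨f2 (t i) - f2 (s i) - ε, by linarith,
        holonomicSpaceCurve_sub_eq_smul_iff.2 ⟨(hdouble i).symm, rfl⟩⟩
  have hset : overcrossings (holonomicSpaceCurve f)
      (fun t => holonomicSpaceCurve f t + ![0, 0, ε]) ![0, 0, 1] = Set.range o := by
    ext ⟨a, b⟩
    constructor
    · rintro ⟨ha, hb, r, hr, hab⟩
      obtain ⟨h1, h2⟩ := holonomicSpaceCurve_sub_eq_smul_iff.1 hab
      have hlt : f2 b < f2 a := by simp only [hf2]; linarith
      obtain ⟨i, ⟨rfl, rfl⟩ | ⟨rfl, rfl⟩⟩ :=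
        hall a ha b hb (fun h => by rw [h] at hlt; exact hlt.false) h1
      · exact ⟨i, if_pos hlt⟩
      · exact ⟨i, if_neg hlt.le.not_gt⟩
    · rintro ⟨i, hi⟩
      obtain ⟨r, hr, h⟩ := hover i
      rw [hi] at h
      refine ⟨?_, ?_, r, hr, h⟩
      · have : (o i).1 ∈ Set.Ico 0 (2 * π) := by
          simp only [o]; split_ifs
          exacts [hs i, ht i]
        rwa [hi] at this
      · have : (o i).2 ∈ Set.Ico 0 (2 * π) := by
          simp only [o]; split_ifs
          exacts [ht i, hs i]
        rwa [hi] at this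
  have hsign : ∀ i, SignType.sign (crossingDet (holonomicSpaceCurve f)
      (fun t => holonomicSpaceCurve f t + ![0, 0, ε]) (o i)) =
        -SignType.sign (deriv f (s i)) := fun i => by
    obtain ⟨r, hr, h⟩ := hover i
    have h1 := holonomicSpaceCurve_sub_eq_smul_iff.1 h
    have hs' : deriv f (o i).1 = deriv f (s i) := by
      simp only [o]; split_ifs
      · rfl
      · exact (holonomicPlaneCurve_eq_iff.1 (hdouble i)).2.symm
    have e := crossingDet_shift hf.smooth h
    rw [Prod.mk.eta] at e
    rw [e, sign_mul, sign_pos hr, sign_mul, hs',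
      sign_neg (a := deriv (deriv f) _ - _) (by linarith [h1.2])]
    simp
  refine ⟨fun a b hab => ?_, ![0, 0, 1], fun h => ?_, ?_, ?_, ?_⟩
  -- An intersection of the knot with its copy would be a double point of c with height gap exactly
  -- ε.
  · obtain ⟨a', ha', haa⟩ : ∃ a' ∈ Set.Ico 0 (2 * π),
        holonomicSpaceCurve f a = holonomicSpaceCurve f a' :=
      hf.knot.periodic.exists_mem_Ico₀ two_pi_pos a
    obtain ⟨b', hb', hbb⟩ : ∃ b' ∈ Set.Ico 0 (2 * π),
        holonomicSpaceCurve f b = holonomicSpaceCurve f b' :=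
      hf.knot.periodic.exists_mem_Ico₀ two_pi_pos b
    have h0 : holonomicSpaceCurve f a' - (holonomicSpaceCurve f b' + ![0, 0, ε]) =
        (0 : ℝ) • ![(0 : ℝ), 0, 1] := by
      rw [← haa, ← hbb, hab]; simp
    obtain ⟨h1, h2⟩ := holonomicSpaceCurve_sub_eq_smul_iff.1 h0
    have hgapε : |f2 a' - f2 b'| = ε := by
      rw [show f2 a' - f2 b' = ε by simp only [hf2]; linarith, abs_of_pos hpos]
    have hne' : a' ≠ b' := fun h => by
      rw [h, sub_self, abs_zero] at hgapε; exact hpos.ne hgapε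
    obtain ⟨i, ⟨rfl, rfl⟩ | ⟨rfl, rfl⟩⟩ := hall a' ha' b' hb' hne' h1
    · exact (hε i).ne' hgapε
    · rw [abs_sub_comm] at hgapε
      exact (hε i).ne' hgapε
  · simpa using congrFun h 2
  · rw [hset]; exact Set.finite_range o
  · rw [hset]
    rintro _ ⟨i, rfl⟩
    rw [← sign_ne_zero, hsign]
    simpa using hne i
  · rw [hset, finsum_mem_range ho]
    refine finsum_congr fun i => ?_
    rw [hsign]
    simp

theorem hasSelfLinkingNumber_zero {f : ℝ → ℝ} (hf : IsFramedHolonomicKnot f)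
    (h : ∀ s ∈ Set.Ico 0 (2 * π), ∀ t ∈ Set.Ico 0 (2 * π),
      holonomicPlaneCurve f s = holonomicPlaneCurve f t → s = t) :
    HasSelfLinkingNumber f 0 := by
  have := hasSelfLinkingNumber_of_doublePoints hf (ι := Empty) (fun i => i.elim) (fun i => i.elim)
    (fun i => i.elim) (fun i => i.elim) (fun i => i.elim) (fun i => i.elim) (fun i => i.elim)
    (fun a ha b hb hab hc => (hab (h a ha b hb hc)).elim) (fun i => i.elim)
  rwa [finsum_of_isEmpty] at this

/-! ### Curves with Whitney index `-1` -/

theorem deriv_neg_of_neg_right {g : ℝ → ℝ} {g' a b : ℝ} (h : HasDerivAt g g' a) (hab : a < b)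
    (ha : g a = 0) (hg : ∀ t ∈ Set.Ioo a b, g t < 0) (h0 : g' ≠ 0) : g' < 0 := by
  refine lt_of_le_of_ne (not_lt.1 fun hpos => ?_) h0
  have hs := (hasDerivAt_iff_tendsto_slope.1 h).eventually_const_lt hpos
  have hr : ∀ᶠ x in 𝓝[>] a, 0 < slope g a x :=
    hs.filter_mono (nhdsWithin_mono _ fun x hx => ne_of_gt hx)
  obtain ⟨x, hx, hxs⟩ := (hr.and (Ioo_mem_nhdsGT hab)).exists
  have h1 := hg x hxs
  rw [slope_def_field, ha] at hx
  have h2 : (g x - 0) / (x - a) < 0 := div_neg_of_neg_of_pos (by linarith) (by linarith [hxs.1])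
  linarith

/-- Start at a global maximum a of f, where θ = nπ + π/2. Over one period θ falls by 2π and
recrosses no vertical level, so it is strictly between consecutive vertical levels on each side of
the point b where it has fallen by π. Thus f' has a constant sign on each arc, and maximality at a
decides which. -/
theorem IsFramedHolonomicKnot.exists_extrema {f : ℝ → ℝ} (hf : IsFramedHolonomicKnot f)
    (hW : whitneyIndex f = -1) :
    ∃ a b : ℝ, a < b ∧ b < a + 2 * π ∧ deriv f a = 0 ∧ deriv f b = 0 ∧
      (∀ t ∈ Set.Ioo a b, deriv f t < 0) ∧ ∀ t ∈ Set.Ioo b (a + 2 * π), 0 < deriv f t := by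
  obtain ⟨θ, hc, hr, hdown, hper⟩ := hf.exists_angle
  rw [hW] at hper
  push_cast at hper
  obtain ⟨a, -, ha⟩ := isCompact_Icc.exists_isMaxOn (Set.nonempty_Icc.2 two_pi_pos.le)
    hf.smooth.continuous.continuousOn
  have hmax : ∀ t, f t ≤ f a := fun t => by
    obtain ⟨s, hs, hst⟩ := hf.periodic.exists_mem_Ico₀ two_pi_pos t
    rw [hst]
    exact ha (Set.Ico_subset_Icc_self hs)
  have ha0 : deriv f a = 0 := IsLocalMax.deriv_eq_zero (Eventually.of_forall hmax)
  have hzero : ∀ t, deriv f t = 0 ↔ cos (θ t) = 0 := fun t => by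
    obtain ⟨r, r0, hx, -⟩ := hr t
    rw [hx]; simp [r0.ne']
  obtain ⟨n, hn⟩ := cos_eq_zero_iff.1 ((hzero a).1 ha0)
  have hn' : θ a = n * π + π / 2 := by rw [hn]; ring
  have hend := hper a
  obtain ⟨b, hb, hbθ⟩ : ∃ b ∈ Set.Icc a (a + 2 * π), θ b = θ a - π := by
    have := intermediate_value_Icc' (f := θ) (a := a) (b := a + 2 * π)
      (by linarith [two_pi_pos]) hc.continuousOn
    exact this ⟨by linarith [pi_pos], by linarith [pi_pos]⟩
  have hab : a < b := lt_of_le_of_ne hb.1 fun h => by subst h; linarith [pi_pos]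
  have hba : b < a + 2 * π := lt_of_le_of_ne hb.2 fun h => by rw [h] at hbθ; linarith [pi_pos]
  have hbn : θ b = (n - 1 : ℤ) * π + π / 2 := by rw [hbθ, hn']; push_cast; ring
  have hcosI : ∀ x, cos (θ a + x) = - sin (n * π + x) := fun x => by
    rw [hn', show n * π + π / 2 + x = (n * π + x) + π / 2 by ring, cos_add_pi_div_two]
  have hsinI : ∀ x, sin (n * π + x) = (-1) ^ n * sin x := fun x => by
    rw [sin_add, sin_int_mul_pi, cos_int_mul_pi]; simp
  have h1 : ∀ t ∈ Set.Ioo a b, ∃ r > 0, deriv f t = r * (-1) ^ n := fun t ht => by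
    obtain ⟨r, r0, hx, -⟩ := hr t
    have hu := hdown n a t ht.1 hn'.le
    have hl : θ b < θ t := not_le.1 fun h => by
      have := hdown (n - 1) t b ht.2 (h.trans hbn.le)
      linarith
    refine ⟨r * sin (θ a - θ t), mul_pos r0 (sin_pos_of_pos_of_lt_pi ?_ ?_), ?_⟩
    · linarith
    · linarith
    · have := hcosI (θ t - θ a)
      rw [hsinI, add_sub_cancel] at this
      rw [hx, this, ← neg_sub (θ a), sin_neg]; ring
  have h2 : ∀ t ∈ Set.Ioo b (a + 2 * π), ∃ r > 0, deriv f t = -(r * (-1) ^ n) := fun t ht => by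
    obtain ⟨r, r0, hx, -⟩ := hr t
    have hu := hdown (n - 1) b t ht.1 hbn.le
    have hl : θ a - 2 * π < θ t := not_le.1 fun h => by
      have := hdown (n - 2) t _ ht.2 (h.trans (by rw [hn']; push_cast; linarith))
      rw [hend, hn'] at this
      push_cast at this
      linarith
    refine ⟨r * sin (θ a - θ t - π), mul_pos r0 (sin_pos_of_pos_of_lt_pi ?_ ?_), ?_⟩
    · linarith
    · linarith
    · have := hcosI (θ t - θ a)
      rw [hsinI, add_sub_cancel] at this
      rw [hx, this, ← neg_sub (θ a), sin_neg, sin_sub_pi]; ring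
  -- For n even, f' would be positive on (a, b), so f b > f a contradicts the maximum.
  rcases Int.even_or_odd n with he | ho
  · obtain ⟨t, ht⟩ := exists_deriv_eq_slope f hab hf.smooth.continuous.continuousOn
      (fun x _ => (hf.smooth.hasDerivAt_deriv x).differentiableAt.differentiableWithinAt)
    obtain ⟨r, r0, hr'⟩ := h1 t ht.1
    rw [he.neg_one_zpow] at hr'
    have : 0 < (f b - f a) / (b - a) := by rw [← ht.2, hr']; simpa using r0
    rw [lt_div_iff₀ (by linarith)] at this
    linarith [hmax b]
  · rw [ho.neg_one_zpow] at h1 h2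
    refine ⟨a, b, hab, hba, ha0, (hzero b).2 ?_, fun t ht => ?_, fun t ht => ?_⟩
    · rw [hbn, cos_add_pi_div_two, sin_int_mul_pi, neg_zero]
    · obtain ⟨r, r0, hr'⟩ := h1 t ht
      rw [hr']; linarith
    · obtain ⟨r, r0, hr'⟩ := h2 t ht
      rw [hr']; linarith

/-- Within one arc x is injective, and the sign of y separates the two arcs. The only remaining
coincidence of y is between the end points a and b, where x differs. -/
theorem eq_of_unimodal {x y : ℝ → ℝ} {a b c : ℝ} (hab : a ≤ b)
    (hx : StrictAntiOn x (Set.Icc a b)) (hx' : StrictMonoOn x (Set.Icc b c))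
    (hy : ∀ t ∈ Set.Ioo a b, y t < 0) (hy' : ∀ t ∈ Set.Ioo b c, 0 < y t)
    (ha : y a = 0) (hb : y b = 0) {s t : ℝ} (hs : s ∈ Set.Ico a c) (ht : t ∈ Set.Ico a c)
    (hxst : x s = x t) (hyst : y s = y t) : s = t := by
  have hmix : ∀ {s t : ℝ}, s ∈ Set.Ico a b → t ∈ Set.Ico b c → x s = x t → y s = y t → False := by
    intro s t hs ht hxst hyst
    have hsa : s = a := by
      by_contra h
      have h1 := hy s ⟨lt_of_le_of_ne hs.1 (Ne.symm h), hs.2⟩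
      rcases ht.1.eq_or_lt with h2 | h2
      · rw [← h2, hb] at hyst; linarith
      · linarith [hy' t ⟨h2, ht.2⟩]
    have htb : t = b := by
      by_contra h
      have h1 := hy' t ⟨lt_of_le_of_ne ht.1 (Ne.symm h), ht.2⟩
      rw [hsa, ha] at hyst
      linarith
    subst hsa htb
    exact (hx ⟨le_rfl, hab⟩ ⟨hab, le_rfl⟩ hs.2).ne' hxst
  rcases lt_or_ge s b with h | h <;> rcases lt_or_ge t b with h' | h'
  · exact hx.injOn ⟨hs.1, h.le⟩ ⟨ht.1, h'.le⟩ hxst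
  · exact (hmix ⟨hs.1, h⟩ ⟨h', ht.2⟩ hxst hyst).elim
  · exact (hmix ⟨ht.1, h'⟩ ⟨h, hs.2⟩ hxst.symm hyst.symm).elim
  · exact hx'.injOn ⟨h, hs.2.le⟩ ⟨h', ht.2.le⟩ hxst

theorem eq_add_of_injOn_Ico {α : Type*} {γ : ℝ → α} {T a : ℝ} (hT : 0 < T)
    (hp : Function.Periodic γ T) (hinj : Set.InjOn γ (Set.Ico a (a + T))) {s t : ℝ}
    (h : γ s = γ t) : ∃ n : ℤ, s = t + n * T := by
  have hmod : ∀ s, γ (toIcoMod hT a s) = γ s := fun s => by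
    rw [toIcoMod]; exact hp.sub_zsmul_eq _
  have := hinj (toIcoMod_mem_Ico hT a s) (toIcoMod_mem_Ico hT a t) (by rw [hmod, hmod, h])
  refine ⟨toIcoDiv hT a s - toIcoDiv hT a t, ?_⟩
  simp only [toIcoMod, zsmul_eq_mul] at this
  push_cast
  linarith

theorem eq_of_eq_add_int_mul {T s t : ℝ} {n : ℤ} (hs : s ∈ Set.Ico 0 T) (ht : t ∈ Set.Ico 0 T)
    (h : s = t + n * T) : s = t := by
  have hT : 0 < T := hs.1.trans_lt hs.2
  have hn1 : (n : ℝ) < 1 := by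
    by_contra hc
    have := mul_le_mul_of_nonneg_right (not_lt.1 hc) hT.le
    linarith [hs.2, ht.1]
  have hn2 : (-1 : ℝ) < n := by
    by_contra hc
    have := mul_le_mul_of_nonneg_right (not_lt.1 hc) hT.le
    linarith [hs.1, ht.2]
  have hn0 : n = 0 := by
    have h1 : n < 1 := by exact_mod_cast hn1
    have h2 : -1 < n := by exact_mod_cast hn2
    lia
  rw [h, hn0]; simp

theorem injective_of_extrema {f : ℝ → ℝ} (hf : ContDiff ℝ ∞ f)
    (hp : Function.Periodic f (2 * π)) {a b : ℝ} (hab : a < b)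
    (ha : deriv f a = 0) (hb : deriv f b = 0) (hneg : ∀ t ∈ Set.Ioo a b, deriv f t < 0)
    (hpos : ∀ t ∈ Set.Ioo b (a + 2 * π), 0 < deriv f t) {s t : ℝ}
    (h : holonomicPlaneCurve f s = holonomicPlaneCurve f t) : ∃ n : ℤ, s = t + n * (2 * π) := by
  refine eq_add_of_injOn_Ico (a := a) two_pi_pos (fun t => ?_) (fun s hs t ht h => ?_) h
  · exact holonomicPlaneCurve_eq_iff.2 ⟨hp t, periodic_deriv hp t⟩
  · obtain ⟨h1, h2⟩ := holonomicPlaneCurve_eq_iff.1 h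
    exact eq_of_unimodal hab.le
      (strictAntiOn_of_deriv_neg (convex_Icc _ _) hf.continuous.continuousOn
        (by rwa [interior_Icc]))
      (strictMonoOn_of_deriv_pos (convex_Icc _ _) hf.continuous.continuousOn
        (by rwa [interior_Icc])) hneg hpos ha hb hs ht h1 h2

/-! ### Isotopies -/

theorem KnotIsotopic.trans {γ η κ : ℝ → Fin 3 → ℝ} (h : KnotIsotopic γ η)
    (h' : KnotIsotopic η κ) : KnotIsotopic γ κ := by
  obtain ⟨H, hH, hk, h0, h1⟩ := h
  obtain ⟨H', hH', hk', h0', h1'⟩ := h'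
  let σ := Real.smoothTransition
  have hσ : ContDiff ℝ ∞ σ := Real.smoothTransition.contDiff
  -- Both isotopies are reparametrized to be stationary near their ends: the first is over by u =
  -- 1/3 and the second starts at u = 2/3. In the middle third both sit at η, and subtracting η once
  -- makes the sum follow a single isotopy at every time while staying visibly smooth.
  let G : ℝ → ℝ → Fin 3 → ℝ := fun u t => H (σ (3 * u)) t + H' (σ (3 * u - 2)) t - η t
  have hη : ContDiff ℝ ∞ η := by
    rw [← h1]; exact (hk 1 (by simp)).smooth
  have hfirst : ∀ u ≤ 2 / 3, G u = H (σ (3 * u)) := fun u hu => by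
    funext t
    have : σ (3 * u - 2) = 0 := Real.smoothTransition.zero_of_nonpos (by linarith)
    simp [G, this, h0']
  have hsecond : ∀ u, 1 / 3 ≤ u → G u = H' (σ (3 * u - 2)) := fun u hu => by
    funext t
    have : σ (3 * u) = 1 := Real.smoothTransition.one_of_one_le (by linarith)
    simp [G, this, h1]
  refine ⟨G, ?_, fun u _ => ?_, ?_, ?_⟩
  · refine ContDiff.sub (ContDiff.add ?_ ?_) (hη.comp contDiff_snd)
    · exact hH.comp ((hσ.comp (contDiff_const.mul contDiff_fst)).prodMk contDiff_snd)
    · exact hH'.comp ((hσ.comp ((contDiff_const.mul contDiff_fst).sub contDiff_const)).prodMk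
        contDiff_snd)
  · rcases le_total u (1 / 2) with hu | hu
    · rw [hfirst u (by linarith)]
      exact hk _ ⟨Real.smoothTransition.nonneg _, Real.smoothTransition.le_one _⟩
    · rw [hsecond u (by linarith)]
      exact hk' _ ⟨Real.smoothTransition.nonneg _, Real.smoothTransition.le_one _⟩
  · rw [hfirst 0 (by norm_num), mul_zero]
    exact (congrArg H Real.smoothTransition.zero).trans h0
  · rw [hsecond 1 (by norm_num), show (3 : ℝ) * 1 - 2 = 1 by norm_num]
    exact (congrArg H' Real.smoothTransition.one).trans h1'

theorem IsSmoothKnot.comp {γ : ℝ → Fin 3 → ℝ} (hγ : IsSmoothKnot γ) {χ : ℝ → ℝ}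
    (hχ : ContDiff ℝ ∞ χ) (hpos : ∀ t, 0 < deriv χ t) (hper : ∀ t, χ (t + 2 * π) = χ t + 2 * π) :
    IsSmoothKnot fun t => γ (χ t) where
  smooth := hγ.smooth.comp hχ
  periodic t := by simp only [hper]; exact hγ.periodic _
  injective := by
    have hmono : StrictMono χ := strictMono_of_deriv_pos hpos
    have hinj : Set.InjOn γ (Set.Ico 0 (0 + 2 * π)) := by rw [zero_add]; exact hγ.injective
    have hlt : ∀ s ∈ Set.Ico 0 (2 * π), ∀ t ∈ Set.Ico 0 (2 * π), s < t →
        γ (χ s) ≠ γ (χ t) := fun s hs t ht hst h => by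
      -- Since χ s < χ t < χ s + 2π, the two values cannot differ by an integer multiple of 2π.
      obtain ⟨n, hn⟩ := eq_add_of_injOn_Ico two_pi_pos hγ.periodic hinj h
      have h1 := hmono hst
      have h2 := hmono (show t < s + 2 * π by linarith [hs.1, ht.2])
      rw [hper] at h2
      have h3 : (n : ℝ) < 0 := by
        by_contra hn0
        have := mul_nonneg (not_lt.1 hn0) two_pi_pos.le
        linarith
      have h4 : (n : ℝ) ≤ -1 := by
        have : n < 0 := by exact_mod_cast h3
        exact_mod_cast (by lia : n ≤ -1)
      have := mul_le_mul_of_nonneg_right h4 two_pi_pos.le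
      linarith
    intro s hs t ht h
    rcases lt_trichotomy s t with hst | hst | hst
    · exact (hlt s hs t ht hst h).elim
    · exact hst
    · exact (hlt t ht s hs hst h.symm).elim
  immersion t := by
    have h1 : HasDerivAt γ (deriv γ (χ t)) (χ t) :=
      ((hγ.smooth.differentiable (by simp)) _).hasDerivAt
    have := h1.scomp t (hχ.hasDerivAt_deriv t)
    change deriv (γ ∘ χ) t ≠ 0
    rw [this.deriv]
    exact smul_ne_zero (hpos t).ne' (hγ.immersion _)

/-- Increasing lifts of circle diffeomorphisms of degree one form a convex set containing the
identity, so ψ can be interpolated linearly to it. -/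
theorem knotIsotopic_comp {γ : ℝ → Fin 3 → ℝ} (hγ : IsSmoothKnot γ) {ψ : ℝ → ℝ}
    (hψ : ContDiff ℝ ∞ ψ) (hpos : ∀ t, 0 < deriv ψ t) (hper : ∀ t, ψ (t + 2 * π) = ψ t + 2 * π) :
    KnotIsotopic γ fun t => γ (ψ t) := by
  refine ⟨fun u t => γ ((1 - u) * t + u * ψ t), ?_, fun u hu => ?_, ?_, ?_⟩
  · refine hγ.smooth.comp ?_
    have := hψ.comp (contDiff_snd (𝕜 := ℝ) (E := ℝ) (F := ℝ))
    exact ((contDiff_const.sub contDiff_fst).mul contDiff_snd).add (contDiff_fst.mul this)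
  · have hd : ∀ t, HasDerivAt (fun t => (1 - u) * t + u * ψ t) ((1 - u) * 1 + u * deriv ψ t) t :=
      fun t => ((hasDerivAt_id t).const_mul _).add ((hψ.hasDerivAt_deriv t).const_mul _)
    refine hγ.comp (χ := fun t => (1 - u) * t + u * ψ t)
      ((contDiff_const.mul contDiff_id).add (contDiff_const.mul hψ)) (fun t => ?_) fun t => ?_
    · rw [(hd t).deriv]
      have := hpos t
      rcases hu.1.eq_or_lt with h | h
      · rw [← h]; norm_num
      · have := mul_pos h this
        linarith [hu.2]
    · rw [hper]; ring
  · simp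
  · simp

/-- There is a diffeomorphism of the circle taking `0, π` to any two given points. -/
theorem exists_circle_diffeo {a b : ℝ} (hab : a < b) (hba : b < a + 2 * π) :
    ∃ ψ : ℝ → ℝ, ContDiff ℝ ∞ ψ ∧ (∀ t, 0 < deriv ψ t) ∧ (∀ t, ψ (t + 2 * π) = ψ t + 2 * π) ∧
      ψ 0 = a ∧ ψ π = b := by
  -- Here arctan (q t) is the argument of 1 + i r e^{it}, so ψ below lifts, up to a rotation, the
  -- action on the circle of the disc automorphism z ↦ (z - i r)/(1 + i r z). Its values at 0 and π
  -- are a and a + π + 4x, which fixes x; the bound |x| < π/4 is |r| < 1.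
  set x := (b - a - π) / 4 with hx
  have hx1 : -(π / 4) < x := by rw [hx]; linarith
  have hx2 : x < π / 4 := by rw [hx]; linarith
  set r := tan x with hr
  have hatan : arctan r = x := arctan_tan (by linarith [pi_pos]) (by linarith [pi_pos])
  have hr1 : -1 < r := by
    have := arctan_strictMono.lt_iff_lt (a := -1) (b := r)
    rw [← this, hatan, arctan_neg, arctan_one]; exact hx1
  have hr2 : r < 1 := by
    have := arctan_strictMono.lt_iff_lt (a := r) (b := 1)
    rw [← this, hatan, arctan_one]; exact hx2
  have hden : ∀ t, 0 < 1 - r * sin t := fun t => by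
    have h1 : |r * sin t| < 1 := by
      rw [abs_mul]
      exact mul_lt_one_of_nonneg_of_lt_one_left (abs_nonneg r) (abs_lt.2 ⟨hr1, hr2⟩)
        (abs_sin_le_one t)
    linarith [(abs_lt.1 h1).2]
  let q : ℝ → ℝ := fun t => r * cos t / (1 - r * sin t)
  have hq : ContDiff ℝ ∞ q :=
    (contDiff_const.mul contDiff_cos).div
      (contDiff_const.sub (contDiff_const.mul contDiff_sin)) fun t => (hden t).ne'
  have hqd : ∀ t, HasDerivAt q
      ((r * -sin t * (1 - r * sin t) - r * cos t * (-(r * cos t))) / (1 - r * sin t) ^ 2) t :=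
    fun t => ((hasDerivAt_cos t).const_mul r).div
      (((hasDerivAt_sin t).const_mul r).const_sub 1) (hden t).ne'
  refine ⟨fun t => t + (a + 2 * x) - 2 * arctan (q t), ?_, fun t => ?_, fun t => ?_, ?_, ?_⟩
  · exact (contDiff_id.add contDiff_const).sub (contDiff_const.mul (contDiff_arctan.comp hq))
  · have hd := (((hasDerivAt_id t).add_const (a + 2 * x))).sub (((hqd t).arctan).const_mul 2)
    have e : deriv (fun t => t + (a + 2 * x) - 2 * arctan (q t)) t =
        (1 - r ^ 2) / ((1 - r * sin t) ^ 2 + (r * cos t) ^ 2) := by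
      refine hd.deriv.trans ?_
      have h1 := (hden t).ne'
      have h2 : (1 - r * sin t) ^ 2 + (r * cos t) ^ 2 ≠ 0 := by
        have := hden t; positivity
      simp only [q]
      field_simp
      linear_combination (-(r ^ 2)) * sin_sq_add_cos_sq t
    rw [e]
    have := hden t
    have : 0 < 1 - r ^ 2 := by nlinarith
    positivity
  · simp only [q, sin_add_two_pi, cos_add_two_pi]; ring
  · simp [q, hatan]
  · simp only [q, cos_pi, sin_pi]
    rw [show r * -1 / (1 - r * 0) = -r by ring, arctan_neg, hatan, hx]; ring

/-- Closed plane curves which go from right to left in the lower half plane and from left to right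
in the upper half plane lift to knots. -/
theorem isSmoothKnot_of_unimodal {x y z : ℝ → ℝ} (hx : ContDiff ℝ ∞ x) (hy : ContDiff ℝ ∞ y)
    (hz : ContDiff ℝ ∞ z) (px : Function.Periodic x (2 * π)) (py : Function.Periodic y (2 * π))
    (pz : Function.Periodic z (2 * π)) (hx1 : ∀ t ∈ Set.Ioo 0 π, deriv x t < 0)
    (hx2 : ∀ t ∈ Set.Ioo π (2 * π), 0 < deriv x t) (hy1 : ∀ t ∈ Set.Ioo 0 π, y t < 0)
    (hy2 : ∀ t ∈ Set.Ioo π (2 * π), 0 < y t) (y0 : y 0 = 0) (yπ : y π = 0)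
    (hy0 : deriv y 0 < 0) (hyπ : 0 < deriv y π) :
    IsSmoothKnot fun t => ![x t, y t, z t] where
  smooth := contDiff_vec3 hx hy hz
  periodic t := by simp only [px t, py t, pz t]
  injective := fun s hs t ht h =>
    eq_of_unimodal pi_pos.le
      (strictAntiOn_of_deriv_neg (convex_Icc _ _) hx.continuous.continuousOn
        (by rwa [interior_Icc]))
      (strictMonoOn_of_deriv_pos (convex_Icc _ _) hx.continuous.continuousOn
        (by rwa [interior_Icc])) hy1 hy2 y0 yπ hs ht (congrFun h 0) (congrFun h 1)
  immersion t h := by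
    rw [deriv_vec3 hx hy hz] at h
    have h0 : deriv x t = 0 := congrFun h 0
    have h1 : deriv y t = 0 := congrFun h 1
    obtain ⟨s, hs, e0, e1⟩ : ∃ s ∈ Set.Ico 0 (2 * π), deriv x s = 0 ∧ deriv y s = 0 := by
      refine ⟨toIcoMod two_pi_pos 0 t, ?_, ?_, ?_⟩
      · simpa using toIcoMod_mem_Ico two_pi_pos 0 t
      · rw [toIcoMod, (periodic_deriv px).sub_zsmul_eq, h0]
      · rw [toIcoMod, (periodic_deriv py).sub_zsmul_eq, h1]
    rcases hs.1.eq_or_lt with h | h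
    · rw [← h] at e1; linarith
    · rcases lt_trichotomy s π with h' | h' | h'
      · linarith [hx1 s ⟨h, h'⟩]
      · rw [h'] at e1; linarith
      · linarith [hx2 s ⟨h', hs.2⟩]

theorem convex_comb_neg {u p q : ℝ} (hu : u ∈ Set.Icc (0 : ℝ) 1) (hp : p < 0) (hq : q < 0) :
    (1 - u) * p + u * q < 0 := by
  have := convex_Iio (𝕜 := ℝ) (0 : ℝ) hp hq (sub_nonneg.2 hu.2) hu.1 (by ring)
  simpa using this

theorem convex_comb_pos {u p q : ℝ} (hu : u ∈ Set.Icc (0 : ℝ) 1) (hp : 0 < p) (hq : 0 < q) :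
    0 < (1 - u) * p + u * q := by
  have := convex_Ioi (𝕜 := ℝ) (0 : ℝ) hp hq (sub_nonneg.2 hu.2) hu.1 (by ring)
  simpa using this

/-- The hypotheses on x and y are convex and hold for the clockwise circle (cos, -sin, 0), while z
plays no role in embeddedness, so the straight-line homotopy stays among knots. Rotating about the
x₀-axis through the angle π then reverses the circle to the counterclockwise one. -/
theorem isUnknot_of_unimodal {x y z : ℝ → ℝ} (hx : ContDiff ℝ ∞ x) (hy : ContDiff ℝ ∞ y)
    (hz : ContDiff ℝ ∞ z) (px : Function.Periodic x (2 * π)) (py : Function.Periodic y (2 * π))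
    (pz : Function.Periodic z (2 * π)) (hx1 : ∀ t ∈ Set.Ioo 0 π, deriv x t < 0)
    (hx2 : ∀ t ∈ Set.Ioo π (2 * π), 0 < deriv x t) (hy1 : ∀ t ∈ Set.Ioo 0 π, y t < 0)
    (hy2 : ∀ t ∈ Set.Ioo π (2 * π), 0 < y t) (y0 : y 0 = 0) (yπ : y π = 0)
    (hy0 : deriv y 0 < 0) (hyπ : 0 < deriv y π) :
    IsUnknot fun t => ![x t, y t, z t] := by
  have sneg : ∀ t ∈ Set.Ioo 0 π, -sin t < 0 := fun t ht => by
    linarith [sin_pos_of_pos_of_lt_pi ht.1 ht.2]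
  have spos : ∀ t ∈ Set.Ioo π (2 * π), 0 < -sin t := fun t ht => by
    have := sin_pos_of_pos_of_lt_pi (x := t - π) (by linarith [ht.1]) (by linarith [ht.2])
    rwa [sin_sub_pi] at this
  have hlin : KnotIsotopic (fun t => ![x t, y t, z t]) (fun t => ![cos t, -sin t, 0]) := by
    refine ⟨fun u t => ![(1 - u) * x t + u * cos t, (1 - u) * y t + u * -sin t, (1 - u) * z t],
      ?_, fun u hu => ?_, ?_, ?_⟩
    · have hu : ContDiff ℝ ∞ fun p : ℝ × ℝ => 1 - p.1 := contDiff_const.sub contDiff_fst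
      exact contDiff_vec3 ((hu.mul (hx.comp contDiff_snd)).add
          (contDiff_fst.mul (contDiff_cos.comp contDiff_snd)))
        ((hu.mul (hy.comp contDiff_snd)).add
          (contDiff_fst.mul (contDiff_sin.comp contDiff_snd).neg)) (hu.mul (hz.comp contDiff_snd))
    · have dx : ∀ t, deriv (fun t => (1 - u) * x t + u * cos t) t =
          (1 - u) * deriv x t + u * -sin t := fun t =>
        (((hx.hasDerivAt_deriv t).const_mul _).add ((hasDerivAt_cos t).const_mul _)).deriv
      have dy : ∀ t, deriv (fun t => (1 - u) * y t + u * -sin t) t =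
          (1 - u) * deriv y t + u * -cos t := fun t =>
        (((hy.hasDerivAt_deriv t).const_mul _).add ((hasDerivAt_sin t).neg.const_mul _)).deriv
      refine isSmoothKnot_of_unimodal
        ((contDiff_const.mul hx).add (contDiff_const.mul contDiff_cos))
        ((contDiff_const.mul hy).add (contDiff_const.mul contDiff_sin.neg))
        (contDiff_const.mul hz) (fun t => ?_) (fun t => ?_) (fun t => ?_) (fun t ht => ?_)
        (fun t ht => ?_) (fun t ht => ?_) (fun t ht => ?_) ?_ ?_ ?_ ?_
      · simp only [px t, cos_add_two_pi]
      · simp only [py t, sin_add_two_pi]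
      · simp only [pz t]
      · rw [dx]; exact convex_comb_neg hu (hx1 t ht) (sneg t ht)
      · rw [dx]; exact convex_comb_pos hu (hx2 t ht) (spos t ht)
      · exact convex_comb_neg hu (hy1 t ht) (sneg t ht)
      · exact convex_comb_pos hu (hy2 t ht) (spos t ht)
      · simp [y0]
      · simp [yπ]
      · rw [dy]; exact convex_comb_neg hu hy0 (by simp)
      · rw [dy]; exact convex_comb_pos hu hyπ (by simp)
    · funext t; simp
    · funext t; simp
  refine hlin.trans ⟨fun u t => ![cos t, -cos (π * u) * sin t, sin (π * u) * sin t],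
    ?_, fun u _ => ?_, ?_, ?_⟩
  · have hu : ContDiff ℝ ∞ fun p : ℝ × ℝ => π * p.1 := contDiff_const.mul contDiff_fst
    exact contDiff_vec3 (contDiff_cos.comp contDiff_snd)
      ((contDiff_cos.comp hu).neg.mul (contDiff_sin.comp contDiff_snd))
      ((contDiff_sin.comp hu).mul (contDiff_sin.comp contDiff_snd))
  · have hsq := sin_sq_add_cos_sq (π * u)
    refine ⟨contDiff_vec3 contDiff_cos (contDiff_const.mul contDiff_sin)
      (contDiff_const.mul contDiff_sin), fun t => ?_, fun s hs t ht h => ?_, fun t h => ?_⟩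
    · simp only [cos_add_two_pi, sin_add_two_pi]
    · have e0 : cos s = cos t := congrFun h 0
      have e1 : -cos (π * u) * sin s = -cos (π * u) * sin t := congrFun h 1
      have e2 : sin (π * u) * sin s = sin (π * u) * sin t := congrFun h 2
      have e3 : sin s = sin t := by
        linear_combination sin (π * u) * e2 - cos (π * u) * e1 - (sin s - sin t) * hsq
      have hang : (s : Real.Angle) = t := Real.Angle.cos_sin_inj e0 e3
      obtain ⟨n, hn⟩ := Real.Angle.angle_eq_iff_two_pi_dvd_sub.1 hang
      exact eq_of_eq_add_int_mul (n := n) hs ht (by linarith)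
    · have hd := deriv_vec3 contDiff_cos (contDiff_const.mul contDiff_sin :
        ContDiff ℝ ∞ fun t => -cos (π * u) * sin t) (contDiff_const.mul contDiff_sin :
        ContDiff ℝ ∞ fun t => sin (π * u) * sin t) t
      rw [h, ((hasDerivAt_cos t)).deriv, ((hasDerivAt_sin t).const_mul _).deriv,
        ((hasDerivAt_sin t).const_mul _).deriv] at hd
      have e0 : 0 = -sin t := congrFun hd 0
      have e1 : 0 = -cos (π * u) * cos t := congrFun hd 1
      have e2 : 0 = sin (π * u) * cos t := congrFun hd 2
      have := sin_sq_add_cos_sq t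
      have e3 : cos t = 0 := by
        linear_combination cos (π * u) * e1 - sin (π * u) * e2 - cos t * hsq
      rw [e3, show sin t = 0 by linarith] at this
      norm_num at this
  · funext t; simp
  · funext t; simp

theorem IsFramedHolonomicKnot.trivial_of_whitneyIndex_eq_neg_one {f : ℝ → ℝ}
    (hf : IsFramedHolonomicKnot f) (hW : whitneyIndex f = -1) :
    HasSelfLinkingNumber f 0 ∧ IsUnknot (holonomicSpaceCurve f) := by
  obtain ⟨a, b, hab, hba, ha, hb, hneg, hpos⟩ := hf.exists_extrema hW
  refine ⟨hasSelfLinkingNumber_zero hf fun s hs t ht h => ?_, ?_⟩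
  · obtain ⟨n, hn⟩ := injective_of_extrema hf.smooth hf.periodic hab ha hb hneg hpos h
    exact eq_of_eq_add_int_mul hs ht hn
  obtain ⟨ψ, hψ, hψ', hper, h0, hπ⟩ := exists_circle_diffeo hab hba
  have hmono : StrictMono ψ := strictMono_of_deriv_pos hψ'
  have h2π : ψ (2 * π) = a + 2 * π := by rw [← h0, ← hper, zero_add]
  have s1 : ∀ t ∈ Set.Ioo 0 π, ψ t ∈ Set.Ioo a b := fun t ht =>
    ⟨h0 ▸ hmono ht.1, hπ ▸ hmono ht.2⟩
  have s2 : ∀ t ∈ Set.Ioo π (2 * π), ψ t ∈ Set.Ioo b (a + 2 * π) := fun t ht =>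
    ⟨hπ ▸ hmono ht.1, h2π ▸ hmono ht.2⟩
  have d1 := contDiff_deriv hf.smooth
  have d2 := contDiff_deriv d1
  have dcomp : ∀ {g : ℝ → ℝ}, ContDiff ℝ ∞ g → ∀ t,
      deriv (fun t => g (ψ t)) t = deriv g (ψ t) * deriv ψ t := fun hg t =>
    ((hg.hasDerivAt_deriv (ψ t)).comp t (hψ.hasDerivAt_deriv t)).deriv
  have pcomp : ∀ {g : ℝ → ℝ}, Function.Periodic g (2 * π) →
      Function.Periodic (fun t => g (ψ t)) (2 * π) := fun hg t => by
    simp only [hper]; exact hg _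
  -- The sign is weak a priori because f' changes sign at the extremum; it is strict since c is
  -- immersed.
  have na : deriv (deriv f) a < 0 :=
    deriv_neg_of_neg_right (d1.hasDerivAt_deriv a) hab ha hneg (jet_ne_zero hf a ha)
  have nb : 0 < deriv (deriv f) b := by
    have := deriv_neg_of_neg_right (d1.hasDerivAt_deriv b).neg hba (by simp [hb])
      (fun t ht => by simpa using hpos t ht) (by simpa using jet_ne_zero hf b hb)
    linarith
  refine (knotIsotopic_comp hf.knot hψ hψ' hper).trans
    (isUnknot_of_unimodal (hf.smooth.comp hψ) (d1.comp hψ) (d2.comp hψ) (pcomp hf.periodic)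
      (pcomp (periodic_deriv hf.periodic)) (pcomp (periodic_deriv (periodic_deriv hf.periodic)))
      (fun t ht => ?_) (fun t ht => ?_) (fun t ht => hneg _ (s1 t ht))
      (fun t ht => hpos _ (s2 t ht)) (by simp [h0, ha]) (by simp [hπ, hb]) ?_ ?_)
  · exact (dcomp hf.smooth t).trans_lt (mul_neg_of_neg_of_pos (hneg _ (s1 t ht)) (hψ' t))
  · exact (mul_pos (hpos _ (s2 t ht)) (hψ' t)).trans_eq (dcomp hf.smooth t).symm
  · refine (dcomp d1 0).trans_lt (mul_neg_of_neg_of_pos ?_ (hψ' 0))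
    rwa [h0]
  · refine (mul_pos ?_ (hψ' π)).trans_eq (dcomp d1 π).symm
    rwa [hπ]

/-! ### Holonomic curves from polar graphs over a multiple cover of the circle -/

/-- The uniform lower bound on the derivative makes T proper, hence onto ℝ; smoothness of the
inverse is the inverse function theorem. -/
theorem exists_contDiff_inverse {T : ℝ → ℝ} (hT : ContDiff ℝ ∞ T) {c : ℝ} (hc : 0 < c)
    (h : ∀ x, c ≤ deriv T x) :
    ∃ Φ : ℝ → ℝ, ContDiff ℝ ∞ Φ ∧ (∀ t, T (Φ t) = t) ∧ ∀ x, Φ (T x) = x := by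
  have hmono : StrictMono T := strictMono_of_deriv_pos fun x => hc.trans_le (h x)
  have hgrow : ∀ ⦃x y⦄, x ≤ y → c * (y - x) ≤ T y - T x := fun x y hxy =>
    mul_sub_le_image_sub_of_le_deriv (hT.differentiable (by simp)) h hxy
  have htop : Tendsto T atTop atTop := by
    refine tendsto_atTop_mono' atTop (f₁ := fun x => c * x + T 0) ?_ ?_
    · filter_upwards [eventually_ge_atTop 0] with x hx
      linarith [hgrow hx]
    · exact tendsto_atTop_add_const_right _ _ (tendsto_id.const_mul_atTop hc)
  have hbot : Tendsto T atBot atBot := by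
    refine tendsto_atBot_mono' atBot (f₁ := fun x => c * x + T 0) ?_ ?_
    · filter_upwards [eventually_le_atBot 0] with x hx
      linarith [hgrow hx]
    · exact tendsto_atBot_add_const_right _ _ (tendsto_id.const_mul_atBot hc)
  let e : ℝ ≃ₜ ℝ := (hmono.orderIsoOfSurjective T (hT.continuous.surjective htop hbot)).toHomeomorph
  have he : ∀ x, e x = T x := fun x => rfl
  refine ⟨e.symm, contDiff_iff_contDiffAt.2 fun t => ?_, e.apply_symm_apply, e.symm_apply_apply⟩
  exact e.toOpenPartialHomeomorph.contDiffAt_symm_deriv (f₀' := deriv T (e.symm t))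
    (hc.trans_le (h _)).ne' trivial (hT.hasDerivAt_deriv _) hT.contDiffAt

/-- If the tangent vector `(p, q)` is never opposite to the direction with angle `α`, it turns as
often as this direction. -/
theorem hasTangentialDegree_of_angle {c : ℝ → Fin 2 → ℝ} {p q α : ℝ → ℝ} {m : ℤ}
    (hd : ∀ t, deriv c t = ![p t, q t]) (hp : Continuous p) (hq : Continuous q)
    (hα : Continuous α) (pp : p (2 * π) = p 0) (pq : q (2 * π) = q 0)
    (hm : α (2 * π) = α 0 + 2 * π * m)
    (h : ∀ t, 0 < p t * cos (α t) + q t * sin (α t) ∨ q t * cos (α t) - p t * sin (α t) ≠ 0) :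
    HasTangentialDegree c m := by
  let z : ℝ → ℂ := fun t =>
    ⟨p t * cos (α t) + q t * sin (α t), q t * cos (α t) - p t * sin (α t)⟩
  have hz : Continuous z := by
    have : z = fun t => Complex.equivRealProdCLM.symm
        (p t * cos (α t) + q t * sin (α t), q t * cos (α t) - p t * sin (α t)) := by
      funext t; apply Complex.ext <;> simp [z]
    rw [this]
    fun_prop
  have hslit : ∀ t, z t ∈ Complex.slitPlane := fun t => h t
  refine ⟨fun t => α t + (z t).arg, ?_, fun t => ⟨‖z t‖, ?_, ?_⟩, ?_⟩
  · exact hα.add (continuous_iff_continuousAt.2 fun t =>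
      (Complex.continuousAt_arg (hslit t)).comp hz.continuousAt)
  · exact norm_pos_iff.2 (Complex.slitPlane_ne_zero (hslit t))
  · have hre : ‖z t‖ * cos (z t).arg = p t * cos (α t) + q t * sin (α t) :=
      Complex.norm_mul_cos_arg (z t)
    have him : ‖z t‖ * sin (z t).arg = q t * cos (α t) - p t * sin (α t) :=
      Complex.norm_mul_sin_arg (z t)
    have hsq := sin_sq_add_cos_sq (α t)
    rw [hd]
    ext i
    fin_cases i
    · simp only [Fin.zero_eta, Matrix.cons_val_zero, Pi.smul_apply, smul_eq_mul, cos_add]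
      linear_combination (-p t) * hsq - cos (α t) * hre + sin (α t) * him
    · simp only [Fin.mk_one, Matrix.cons_val_one, Matrix.cons_val_fin_one, Pi.smul_apply,
        smul_eq_mul, sin_add]
      linear_combination (-q t) * hsq - sin (α t) * hre - cos (α t) * him
  · have hcos : cos (α (2 * π)) = cos (α 0) := by
      rw [hm, mul_comm (2 * π) (m : ℝ), cos_add_int_mul_two_pi]
    have hsin : sin (α (2 * π)) = sin (α 0) := by
      rw [hm, mul_comm (2 * π) (m : ℝ), sin_add_int_mul_two_pi]
    have : z (2 * π) = z 0 := by simp only [z, pp, pq, hcos, hsin]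
    simp only [this, hm]
    ring

/-- The sheet coordinate of an angle: an increasing function with critical points in `πℤ` which
increases by `1` along a full turn. -/
noncomputable def sheetCoord (φ : ℝ) : ℝ := (φ - sin φ * cos φ) / (2 * π)

theorem hasDerivAt_sheetCoord (φ : ℝ) : HasDerivAt sheetCoord (sin φ ^ 2 / π) φ := by
  have h := ((hasDerivAt_id φ).sub ((hasDerivAt_sin φ).mul (hasDerivAt_cos φ))).div_const (2 * π)
  refine h.congr_deriv ?_
  field_simp
  linear_combination -sin_sq_add_cos_sq φ

theorem contDiff_sheetCoord : ContDiff ℝ ∞ sheetCoord :=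
  (contDiff_id.sub (contDiff_sin.mul contDiff_cos)).div_const _

theorem sheetCoord_add (φ : ℝ) (j : ℤ) : sheetCoord (φ + j * (2 * π)) = sheetCoord φ + j := by
  simp only [sheetCoord, sin_add_int_mul_two_pi, cos_add_int_mul_two_pi]
  field_simp
  ring

/-- The derivative vanishes on πℤ, so strictness is taken from |sin d| < |d| for d ≠ 0 instead. -/
theorem sheetCoord_strictMono : StrictMono sheetCoord := fun x y hxy => by
  have h1 : sin y * cos y - sin x * cos x = sin (y - x) * cos (y + x) := by
    rw [sin_sub, cos_add]
    linear_combination (sin y * cos y) * (-sin_sq_add_cos_sq x) +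
      (sin x * cos x) * sin_sq_add_cos_sq y
  have h2 : sin (y - x) * cos (y + x) < y - x := by
    have hd : 0 < y - x := sub_pos.2 hxy
    calc sin (y - x) * cos (y + x) ≤ |sin (y - x) * cos (y + x)| := le_abs_self _
      _ = |sin (y - x)| * |cos (y + x)| := abs_mul _ _
      _ ≤ |sin (y - x)| := mul_le_of_le_one_right (abs_nonneg _) (abs_cos_le_one _)
      _ < y - x := by
        have := abs_sin_lt_abs hd.ne'
        rwa [abs_of_pos hd] at this
  exact div_lt_div_of_pos_right (by linarith) two_pi_pos

theorem sign_sin_of_mem_Ioo {x : ℝ} {i : ℤ} (hx : x ∈ Set.Ioo (i * π) ((i + 1) * π)) :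
    SignType.sign (sin x) = SignType.sign ((-1 : ℝ) ^ i) := by
  have h : sin x = (-1) ^ i * sin (x - i * π) := by
    rw [sin_sub, sin_int_mul_pi, cos_int_mul_pi]
    rcases Int.even_or_odd i with hi | hi
    · simp [hi.neg_one_zpow]
    · simp [hi.neg_one_zpow]
  rw [h, sign_mul, sign_pos (sin_pos_of_pos_of_lt_pi _ _), mul_one]
  · linarith [hx.1]
  · linarith [hx.2]

/-- The increasing map φ ↦ 2π `sheetCoord` φ fixes every point of πℤ, hence preserves each interval
between them, where sin has constant sign. -/
theorem sign_sin_sheetCoord (φ : ℝ) :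
    SignType.sign (sin (2 * π * sheetCoord φ)) = SignType.sign (sin φ) := by
  have hval : ∀ i : ℤ, 2 * π * sheetCoord (i * π) = i * π := fun i => by
    simp only [sheetCoord, sin_int_mul_pi]
    field_simp
    ring
  have hmono : StrictMono fun φ => 2 * π * sheetCoord φ := fun x y h =>
    mul_lt_mul_of_pos_left (sheetCoord_strictMono h) two_pi_pos
  set i := ⌊φ / π⌋ with hi
  have h1 : i * π ≤ φ := (le_div_iff₀ pi_pos).1 (Int.floor_le _)
  have h2 : φ < (i + 1) * π := (div_lt_iff₀ pi_pos).1 (Int.lt_floor_add_one _)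
  rcases h1.eq_or_lt with h | h
  · rw [← h, hval]
  · rw [sign_sin_of_mem_Ioo ⟨h, h2⟩, sign_sin_of_mem_Ioo (i := i)]
    refine ⟨(hval i).symm.trans_lt (hmono h), (hmono h2).trans_eq ?_⟩
    have := hval (i + 1)
    push_cast at this
    exact this

/-- Take f = e^L cos Φ with Φ the angle as a function of time, and ask for f' = -c e^L sin Φ. This
amounts to Φ' (sin Φ - L' cos Φ) = c sin Φ, and L' = μ sin² lets sin Φ be divided out: Φ' = c/g with
g = 1 - μ sin cos. Smallness of δ keeps g positive, and c normalizes the period to 2π. The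
coordinate Y is `sheetCoord` ∘ Φ. -/
theorem exists_framedHolonomicKnot_of_sheets {k : ℕ} (hk : 0 < k) {M : ℝ → ℝ}
    (hM : ContDiff ℝ ∞ M) (hp : Function.Periodic M k)
    (hcross : ∀ x ∈ Set.Ico (0 : ℝ) k, ∀ y ∈ Set.Ico (0 : ℝ) k, x ≠ y → (∃ j : ℤ, x = y + j) →
      M x = M y → deriv M x ≠ deriv M y ∧ sin (2 * π * x) ≠ 0) :
    ∃ f Y : ℝ → ℝ, IsFramedHolonomicKnot f ∧
      HasTangentialDegree (holonomicPlaneCurve f) (-k) ∧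
      (∀ t ∈ Set.Ico 0 (2 * π), Y t ∈ Set.Ico (0 : ℝ) k) ∧
      (∀ y ∈ Set.Ico (0 : ℝ) k, ∃ t ∈ Set.Ico 0 (2 * π), Y t = y) ∧ Function.Injective Y ∧
      (∀ s t, holonomicPlaneCurve f s = holonomicPlaneCurve f t ↔
        M (Y s) = M (Y t) ∧ ∃ j : ℤ, Y s = Y t + j) ∧
      ∀ t, SignType.sign (deriv f t) = -SignType.sign (sin (2 * π * Y t)) := by
  have hM' := contDiff_deriv hM
  have hp' := periodic_deriv hp
  have hk0 : (0 : ℝ) < k := Nat.cast_pos.2 hk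
  -- a small multiple of `M` is the logarithm of the radius
  obtain ⟨δ, hδ, hδM⟩ : ∃ δ : ℝ, 0 < δ ∧ ∀ y, |δ * deriv M y / π| ≤ 1 / 2 := by
    obtain ⟨B, hB⟩ := isCompact_Icc.exists_bound_of_continuousOn
      (hM'.continuous.continuousOn (s := Set.Icc (0 : ℝ) k))
    have hB' : ∀ y, |deriv M y| ≤ |B| + 1 := fun y => by
      obtain ⟨x, hx, h⟩ := hp'.exists_mem_Ico₀ hk0 y
      rw [h]
      linarith [hB x (Set.Ico_subset_Icc_self hx), le_abs_self B, Real.norm_eq_abs (deriv M x)]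
    have hB0 : 0 < |B| + 1 := by positivity
    refine ⟨π / (2 * (|B| + 1)), by positivity, fun y => ?_⟩
    rw [show π / (2 * (|B| + 1)) * deriv M y / π = deriv M y / (2 * (|B| + 1)) by field_simp,
      abs_div, abs_of_pos (by positivity : 0 < 2 * (|B| + 1)), div_le_iff₀ (by positivity)]
    linarith [hB' y]
  let μ : ℝ → ℝ := fun φ => δ * deriv M (sheetCoord φ) / π
  let L : ℝ → ℝ := fun φ => δ * M (sheetCoord φ)
  let g : ℝ → ℝ := fun φ => 1 - μ φ * (sin φ * cos φ)
  have hμ : ContDiff ℝ ∞ μ := (contDiff_const.mul (hM'.comp contDiff_sheetCoord)).div_const _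
  have hL : ContDiff ℝ ∞ L := contDiff_const.mul (hM.comp contDiff_sheetCoord)
  have hL' : ∀ φ, HasDerivAt L (μ φ * sin φ ^ 2) φ := fun φ => by
    have := ((hM.hasDerivAt_deriv (sheetCoord φ)).comp φ (hasDerivAt_sheetCoord φ)).const_mul δ
    refine this.congr_deriv ?_
    simp only [μ]; ring
  have hg : ContDiff ℝ ∞ g := contDiff_const.sub (hμ.mul (contDiff_sin.mul contDiff_cos))
  have hg2 : ∀ φ, 1 / 2 ≤ g φ := fun φ => by
    have h1 : |μ φ * (sin φ * cos φ)| ≤ 1 / 2 := by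
      rw [abs_mul, abs_mul]
      have h2 : |sin φ| * |cos φ| ≤ 1 :=
        mul_le_one₀ (abs_sin_le_one φ) (abs_nonneg _) (abs_cos_le_one φ)
      calc |μ φ| * (|sin φ| * |cos φ|) ≤ 1 / 2 * 1 :=
            mul_le_mul (hδM _) h2 (by positivity) (by norm_num)
        _ = 1 / 2 := mul_one _
    linarith [(abs_le.1 h1).2]
  have hg0 : ∀ φ, 0 < g φ := fun φ => by linarith [hg2 φ]
  have hshift : ∀ φ, sheetCoord (φ + 2 * π * k) = sheetCoord φ + k := fun φ => by
    have := sheetCoord_add φ k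
    rwa [Int.cast_natCast, mul_comm (k : ℝ)] at this
  have hgper : Function.Periodic g (2 * π * k) := fun φ => by
    have h1 : μ (φ + 2 * π * k) = μ φ := by simp only [μ, hshift, hp' _]
    simp only [g, h1]
    rw [mul_comm (2 * π), sin_add_nat_mul_two_pi, cos_add_nat_mul_two_pi]
  -- the time at which the angle `φ` is attained, normalized below to have period `2π`
  let T : ℝ → ℝ := fun φ => ∫ x in (0 : ℝ)..φ, g x
  have hT : ∀ φ, HasDerivAt T (g φ) φ := fun φ =>
    (hg.continuous.integral_hasStrictDerivAt 0 φ).hasDerivAt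
  have hTd : deriv T = g := funext fun φ => (hT φ).deriv
  have hTs : ContDiff ℝ ∞ T :=
    contDiff_infty_iff_deriv.2 ⟨fun φ => (hT φ).differentiableAt, by rwa [hTd]⟩
  have hT0 : T 0 = 0 := intervalIntegral.integral_same
  have hTper : ∀ φ, T (φ + 2 * π * k) = T φ + T (2 * π * k) := fun φ => by
    have h1 := intervalIntegral.integral_add_adjacent_intervals
      (hg.continuous.intervalIntegrable (μ := MeasureTheory.volume) 0 φ)
      (hg.continuous.intervalIntegrable φ (φ + 2 * π * k))
    have h2 := hgper.intervalIntegral_add_eq φ 0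
    rw [zero_add] at h2
    rw [h2] at h1
    exact h1.symm
  have hTmono : StrictMono T := strictMono_of_deriv_pos fun x => by rw [hTd]; exact hg0 x
  have hTk : 0 < T (2 * π * k) := by
    rw [← hT0]; exact hTmono (by positivity)
  set c := T (2 * π * k) / (2 * π) with hc
  have hc0 : 0 < c := div_pos hTk two_pi_pos
  have hΘ : ∀ φ, HasDerivAt (fun φ => T φ / c) (g φ / c) φ := fun φ => (hT φ).div_const c
  obtain ⟨Φ, hΦs, hΦ1, hΦ2⟩ := exists_contDiff_inverse (T := fun φ => T φ / c)
    (hTs.div_const c) (c := 1 / 2 / c) (by positivity) fun φ => by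
      rw [(hΘ φ).deriv]; exact div_le_div_of_nonneg_right (hg2 φ) hc0.le
  have hΦ : ∀ t, HasDerivAt Φ (c / g (Φ t)) t := fun t => by
    have h1 := (hΘ (Φ t)).comp t (hΦs.hasDerivAt_deriv t)
    have h2 : ((fun φ => T φ / c) ∘ Φ) = id := funext hΦ1
    rw [h2] at h1
    have h3 := h1.unique (hasDerivAt_id t)
    refine (hΦs.hasDerivAt_deriv t).congr_deriv ?_
    have := (hg0 (Φ t)).ne'
    field_simp at h3 ⊢
    linarith
  have hΦmono : StrictMono Φ := strictMono_of_deriv_pos fun t => by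
    rw [(hΦ t).deriv]; exact div_pos hc0 (hg0 _)
  have hΦper : ∀ t, Φ (t + 2 * π) = Φ t + 2 * π * k := fun t => by
    rw [← hΦ2 (Φ t + 2 * π * k)]
    congr 1
    rw [hTper, add_div, hΦ1, hc]
    field_simp
  have hΦ0 : Φ 0 = 0 := by
    have := hΦ2 0
    rwa [hT0, zero_div] at this
  have hΦ2π : Φ (2 * π) = 2 * π * k := by
    have := hΦper 0
    rwa [zero_add, hΦ0, zero_add] at this
  have hLper : ∀ t, L (Φ (t + 2 * π)) = L (Φ t) := fun t => by
    simp only [L, hΦper, hshift, hp _]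
  -- the function and its derivatives
  let f : ℝ → ℝ := fun t => exp (L (Φ t)) * cos (Φ t)
  have hf : ContDiff ℝ ∞ f :=
    (contDiff_exp.comp (hL.comp hΦs)).mul (contDiff_cos.comp hΦs)
  have hE : ∀ t, HasDerivAt (fun t => exp (L (Φ t)))
      (exp (L (Φ t)) * (μ (Φ t) * sin (Φ t) ^ 2 * (c / g (Φ t)))) t := fun t =>
    ((hL' (Φ t)).comp t (hΦ t)).exp
  -- The product rule gives a factor sin Φ times g (Φ t), and the latter cancels against Φ' = c/g.
  have hf1 : deriv f = fun t => -(c * (exp (L (Φ t)) * sin (Φ t))) := funext fun t => by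
    have := (hE t).mul ((hΦ t).cos)
    refine this.deriv.trans ?_
    have := (hg0 (Φ t)).ne'
    field_simp
    simp only [g]
    ring
  have hf2 : ∀ t, deriv (deriv f) t =
      -(c ^ 2 * exp (L (Φ t)) * ((μ (Φ t) * sin (Φ t) ^ 3 + cos (Φ t)) / g (Φ t))) := fun t => by
    rw [hf1]
    have := (((hE t).mul ((hΦ t).sin)).const_mul c).neg
    refine this.deriv.trans ?_
    have := (hg0 (Φ t)).ne'
    field_simp
  have hper : Function.Periodic f (2 * π) := fun t => by
    simp only [f, hLper]
    rw [hΦper, mul_comm (2 * π), cos_add_nat_mul_two_pi]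
  have hplane : ∀ s t, holonomicPlaneCurve f s = holonomicPlaneCurve f t ↔
      M (sheetCoord (Φ s)) = M (sheetCoord (Φ t)) ∧
        ∃ j : ℤ, sheetCoord (Φ s) = sheetCoord (Φ t) + j := fun s t => by
    rw [holonomicPlaneCurve_eq_iff, hf1]
    constructor
    · rintro ⟨h1, h2⟩
      have h2 : exp (L (Φ s)) * sin (Φ s) = exp (L (Φ t)) * sin (Φ t) :=
        mul_left_cancel₀ hc0.ne' (neg_injective h2)
      have hone := polar_angle_unique (exp_pos _) (exp_pos _) h1 h2
      obtain ⟨j, hj⟩ := (cos_eq_one_iff _).1 hone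
      have hj' : Φ s = Φ t + j * (2 * π) := by linarith
      have hcs : cos (Φ s) = cos (Φ t) := by rw [hj', cos_add_int_mul_two_pi]
      have hsn : sin (Φ s) = sin (Φ t) := by rw [hj', sin_add_int_mul_two_pi]
      refine ⟨?_, j, by rw [hj', sheetCoord_add]⟩
      have he : exp (L (Φ s)) = exp (L (Φ t)) := by
        rw [hsn] at h2
        have h1 : exp (L (Φ s)) * cos (Φ s) = exp (L (Φ t)) * cos (Φ t) := h1
        rw [hcs] at h1
        linear_combination sin (Φ t) * h2 + cos (Φ t) * h1 -
          (exp (L (Φ s)) - exp (L (Φ t))) * sin_sq_add_cos_sq (Φ t)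
      exact mul_left_cancel₀ hδ.ne' (exp_injective he)
    · rintro ⟨h1, j, hj⟩
      rw [← sheetCoord_add] at hj
      have hj' := sheetCoord_strictMono.injective hj
      have hcs : cos (Φ s) = cos (Φ t) := by rw [hj', cos_add_int_mul_two_pi]
      have hsn : sin (Φ s) = sin (Φ t) := by rw [hj', sin_add_int_mul_two_pi]
      simp only [f, L, h1, hcs, hsn, and_self]
  have hY0 : sheetCoord 0 = 0 := by simp [sheetCoord]
  have hYk : sheetCoord (2 * π * k) = k := by
    have := hshift 0
    rwa [zero_add, hY0, zero_add] at this
  have hYmono : StrictMono fun t => sheetCoord (Φ t) := sheetCoord_strictMono.comp hΦmono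
  have hYmem : ∀ t ∈ Set.Ico 0 (2 * π), sheetCoord (Φ t) ∈ Set.Ico (0 : ℝ) k := fun t ht => by
    constructor
    · rw [← hY0, ← hΦ0]; exact hYmono.monotone ht.1
    · rw [← hYk, ← hΦ2π]; exact hYmono ht.2
  refine ⟨f, fun t => sheetCoord (Φ t), ?_, ?_, hYmem, fun y hy => ?_, hYmono.injective, hplane,
    fun t => ?_⟩
  · refine framedHolonomicKnot_of_jets hf hper (fun t h0 => ?_) fun s hs t ht h0 h1 h2 => ?_
    · have hsin : sin (Φ t) = 0 := by
        rw [hf1] at h0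
        simpa [hc0.ne', (exp_pos _).ne'] using h0
      have hcos : cos (Φ t) ≠ 0 := fun h => by
        have := sin_sq_add_cos_sq (Φ t)
        rw [hsin, h] at this; norm_num at this
      rw [hf2, hsin]
      refine neg_ne_zero.2 (mul_ne_zero (by positivity) (div_ne_zero ?_ (hg0 _).ne'))
      rwa [zero_pow three_ne_zero, mul_zero, zero_add]
    · obtain ⟨hMst, j, hj⟩ := (hplane s t).1 (holonomicPlaneCurve_eq_iff.2 ⟨h0, h1⟩)
      by_contra hst
      obtain ⟨hne, hsin⟩ := hcross _ (hYmem s hs) _ (hYmem t ht) (hYmono.injective.ne hst) ⟨j, hj⟩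
        hMst
      have hsin' : sin (Φ s) ≠ 0 := by
        rwa [← sign_ne_zero, ← sign_sin_sheetCoord, sign_ne_zero]
      have hj' : Φ s = Φ t + j * (2 * π) := by
        rw [← sheetCoord_add] at hj
        exact sheetCoord_strictMono.injective hj
      have hcs : cos (Φ t) = cos (Φ s) := by rw [hj', cos_add_int_mul_two_pi]
      have hsn : sin (Φ t) = sin (Φ s) := by rw [hj', sin_add_int_mul_two_pi]
      have hLst : L (Φ s) = L (Φ t) := congrArg (δ * ·) hMst
      rw [hf2, hf2, ← hLst, hcs, hsn] at h2
      have h3 := mul_left_cancel₀ (by positivity : c ^ 2 * exp (L (Φ s)) ≠ 0) (neg_injective h2)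
      rw [div_eq_div_iff (hg0 _).ne' (hg0 _).ne'] at h3
      simp only [g, hcs, hsn] at h3
      -- With equal angle and radius, the equality of second derivatives cross-multiplies to (μ(Φ s)
      -- - μ(Φ t)) sin Φ = 0. So the strands have distinct heights exactly because the sheets cross
      -- with different slopes off the x₀-axis.
      have h4 : (μ (Φ s) - μ (Φ t)) * sin (Φ s) = 0 := by
        linear_combination h3 - (μ (Φ s) - μ (Φ t)) * sin (Φ s) * sin_sq_add_cos_sq (Φ s)
      have h5 := sub_eq_zero.1 ((mul_eq_zero.1 h4).resolve_right hsin')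
      refine hne ?_
      simp only [μ] at h5
      field_simp at h5
      exact h5
  · have d1 := contDiff_deriv hf
    -- The comparison direction (-sin Φ, -cos Φ) is the clockwise tangent of a circle reflected to
    -- its own parametrization, and it turns -k times. Where sin Φ ≠ 0 and (f', f'') is parallel to
    -- it, their inner product is c e^L > 0.
    refine hasTangentialDegree_of_angle (α := fun t => -Φ t - π / 2)
      (deriv_holonomicPlaneCurve hf) d1.continuous (contDiff_deriv d1).continuous
      (by have := hΦs.continuous; fun_prop) ?_ ?_ ?_ fun t => ?_
    · simpa using periodic_deriv hper 0
    · simpa using periodic_deriv (periodic_deriv hper) 0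
    · rw [hΦ2π, hΦ0]; push_cast; ring
    · have hcosα : cos (-Φ t - π / 2) = -sin (Φ t) := by
        rw [cos_sub_pi_div_two, sin_neg]
      have hsinα : sin (-Φ t - π / 2) = -cos (Φ t) := by
        rw [sin_sub_pi_div_two, cos_neg]
      have hf1t := congrFun hf1 t
      have hA : 0 < c * exp (L (Φ t)) := by positivity
      by_cases hs : sin (Φ t) = 0
      · left
        have hcos2 : cos (Φ t) ^ 2 = 1 := by
          have := sin_sq_add_cos_sq (Φ t)
          rw [hs] at this; linarith
        rw [hcosα, hsinα, hf2, hs]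
        have h1 : 0 < c ^ 2 * exp (L (Φ t)) / g (Φ t) :=
          div_pos (by positivity) (hg0 _)
        refine h1.trans_eq ?_
        linear_combination (-(c ^ 2 * exp (L (Φ t)) / g (Φ t))) * hcos2
      · by_contra! h
        obtain ⟨h1, h2⟩ := h
        rw [hcosα, hsinα] at h1 h2
        have h3 : (deriv f t * -sin (Φ t) + deriv (deriv f) t * -cos (Φ t)) * sin (Φ t) =
            c * exp (L (Φ t)) * sin (Φ t) := by
          linear_combination (-sin_sq_add_cos_sq (Φ t)) * deriv f t + cos (Φ t) * h2 - hf1t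
        have h4 := mul_right_cancel₀ hs h3
        linarith
  · have hT' : ∃ φ, sheetCoord φ = y ∧ φ ∈ Set.Ico 0 (2 * π * k) := by
      have h := intermediate_value_Ico (f := sheetCoord) (a := 0) (b := 2 * π * k) (by positivity)
        contDiff_sheetCoord.continuous.continuousOn
      rw [hY0, hYk] at h
      obtain ⟨φ, hφ, h⟩ := h hy
      exact ⟨φ, h, hφ⟩
    obtain ⟨φ, hφ, h0, h1⟩ := hT'
    refine ⟨T φ / c, ⟨?_, ?_⟩, by simp only [hΦ2, hφ]⟩
    · rw [← hΦmono.le_iff_le, hΦ0, hΦ2]; exact h0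
    · rw [← hΦmono.lt_iff_lt, hΦ2π, hΦ2]; exact h1
  · rw [hf1, Left.sign_neg, sign_mul, sign_mul, sign_pos hc0, sign_pos (exp_pos _), one_mul,
      one_mul, sign_sin_sheetCoord]

/-! ### Graphs over a multiple cover of the circle with prescribed double points -/

theorem hasDerivAt_expNegInvGlue {x : ℝ} (hx : 0 < x) :
    HasDerivAt expNegInvGlue (expNegInvGlue x * (x ^ 2)⁻¹) x := by
  have h : HasDerivAt (fun x : ℝ => exp (-x⁻¹)) (exp (-x⁻¹) * (x ^ 2)⁻¹) x := by
    have := (hasDerivAt_inv hx.ne').neg.exp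
    simpa using this
  have he : ∀ y > (0 : ℝ), expNegInvGlue y = exp (-y⁻¹) := fun y hy => by
    simp [expNegInvGlue, not_le.2 hy]
  rw [he x hx]
  exact h.congr_of_eventuallyEq ((eventually_gt_nhds hx).mono he)

/-- For the quotient p/(p + p'), with p increasing and p' decreasing in x, the numerator of the
derivative is a sum of two positive terms. Positivity later yields transversality of the sheet
crossings. -/
theorem exists_hasDerivAt_smoothTransition_pos {x : ℝ} (h0 : 0 < x) (h1 : x < 1) :
    ∃ d : ℝ, 0 < d ∧ HasDerivAt smoothTransition d x := by
  have hx := hasDerivAt_expNegInvGlue h0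
  have hx' := (hasDerivAt_expNegInvGlue (sub_pos.2 h1)).comp x ((hasDerivAt_id x).const_sub 1)
  refine ⟨_, ?_, hx.div (hx.add hx') (smoothTransition.pos_denom x).ne'⟩
  have p := expNegInvGlue.pos_of_pos h0
  have p' := expNegInvGlue.pos_of_pos (sub_pos.2 h1)
  have q : 0 < (x ^ 2)⁻¹ := by positivity
  have q' : 0 < ((1 - x) ^ 2)⁻¹ := by have := sub_pos.2 h1; positivity
  refine div_pos ?_ (by have := smoothTransition.pos_denom x; simpa using pow_pos this 2)
  have h1 := mul_pos (mul_pos p q) p'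
  have h2 := mul_pos p (mul_pos p' q')
  refine (add_pos h1 h2).trans_eq ?_
  simp
  ring

theorem smoothTransition_strictMonoOn : StrictMonoOn smoothTransition (Set.Icc 0 1) :=
  strictMonoOn_of_deriv_pos (convex_Icc _ _) smoothTransition.continuous.continuousOn fun x hx => by
    rw [interior_Icc] at hx
    obtain ⟨d, hd, h⟩ := exists_hasDerivAt_smoothTransition_pos hx.1 hx.2
    rwa [h.deriv]

theorem exists_smoothTransition_eq {v : ℝ} (hv : v ∈ Set.Ioo (0 : ℝ) 1) :
    ∃ x ∈ Set.Ioo (0 : ℝ) 1, smoothTransition x = v := by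
  have := intermediate_value_Ioo (f := smoothTransition) zero_le_one
    smoothTransition.continuous.continuousOn
  rw [smoothTransition.zero, smoothTransition.one] at this
  exact this hv

/-- A function which vanishes on the negative half line and at the end of an interval
`[0, T)` extends periodically from this interval. -/
theorem exists_periodic_extension {F : ℝ → ℝ} (hF : ContDiff ℝ ∞ F) {b T : ℝ} (hT : 0 < T)
    (hb : b < T) (h0 : ∀ y ≤ 0, F y = 0) (h1 : ∀ y, b ≤ y → F y = 0) :
    ∃ M : ℝ → ℝ, ContDiff ℝ ∞ M ∧ Function.Periodic M T ∧ (∀ y ∈ Set.Ico 0 T, M y = F y) ∧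
      ∀ y ∈ Set.Ico 0 T, deriv M y = deriv F y := by
  let M : ℝ → ℝ := fun y => F (toIcoMod hT 0 y)
  -- Each window starts T - b before nT, on a stretch where the preceding translate of F has already
  -- vanished and the next one is still zero. So M is locally a single smooth translate of F, also
  -- at the seams.
  have hloc : ∀ (n : ℤ) (z : ℝ), z ∈ Set.Ioo (n * T - (T - b)) ((n + 1) * T) →
      M z = F (z - n * T) := fun n z hz => by
    rcases lt_or_ge z (n * T) with h | h
    · rw [h0 (z - n * T) (by linarith)]
      by_cases hlow : (n - 1) * T ≤ z
      · have : toIcoMod hT 0 z = z - (n - 1 : ℤ) * T :=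
          (toIcoMod_eq_iff hT).2 ⟨⟨by push_cast; linarith, by push_cast; linarith⟩, n - 1, by simp⟩
        simp only [M, this]
        exact h1 _ (by push_cast; linarith [hz.1])
      · have hb0 : b < 0 := by
          have := hz.1
          linarith [not_le.1 hlow]
        exact h1 _ (by linarith [(toIcoMod_mem_Ico hT 0 z).1])
    · have : toIcoMod hT 0 z = z - n * T :=
        (toIcoMod_eq_iff hT).2 ⟨⟨by linarith, by linarith [hz.2]⟩, n, by simp⟩
      simp only [M, this]
  have hev : ∀ y, ∃ n : ℤ, M =ᶠ[𝓝 y] fun z => F (z - n * T) := fun y => by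
    refine ⟨toIcoDiv hT 0 y, ?_⟩
    have h := toIcoMod_mem_Ico hT 0 y
    simp only [toIcoMod, zsmul_eq_mul, Set.mem_Ico] at h
    filter_upwards [Ioo_mem_nhds (a := toIcoDiv hT 0 y * T - (T - b))
      (b := (toIcoDiv hT 0 y + 1) * T) (by linarith) (by linarith)] with z hz using hloc _ z hz
  refine ⟨M, contDiff_iff_contDiffAt.2 fun y => ?_, fun y => ?_, fun y hy => ?_, fun y hy => ?_⟩
  · obtain ⟨n, hn⟩ := hev y
    exact (hF.comp (contDiff_id.sub contDiff_const)).contDiffAt.congr_of_eventuallyEq hn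
  · simp only [M, toIcoMod_add_right]
  · have := hloc 0 y ⟨by simp; linarith [hy.1], by simpa using hy.2⟩
    simpa using this
  · refine Filter.EventuallyEq.deriv_eq ?_
    filter_upwards [Ioo_mem_nhds (a := -(T - b)) (b := T) (by linarith [hy.1]) hy.2] with z hz
    have := hloc 0 z ⟨by simpa using hz.1, by simpa using hz.2⟩
    simpa using this

/-- A smooth step from `0` to `1` on the interval `[0, 1/4]`. -/
noncomputable def quarterStep (u : ℝ) : ℝ := smoothTransition (4 * u)

/-- A function which oscillates `r` times between `0` and `1` on the interval `[a, a + 1/4]`. -/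
noncomputable def wiggle (r : ℕ) (a u : ℝ) : ℝ := (1 - cos (2 * π * r * quarterStep (u - a))) / 2

/-- A function on `[0, K + 1)` such that the sheets `0, …, K - 1` move up by `1`, the sheet `K`
crosses all of them downwards, and the two lowest sheets cross each other another `2 r` times. -/
noncomputable def sheetHeight (K r : ℕ) (a y : ℝ) : ℝ :=
  ∑ i ∈ Finset.range K, quarterStep (y - i) - K * quarterStep (y - K) +
    wiggle r a (y - K) - wiggle r a y

theorem contDiff_quarterStep : ContDiff ℝ ∞ quarterStep :=
  smoothTransition.contDiff.comp (contDiff_const.mul contDiff_id)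

theorem quarterStep_of_nonpos {u : ℝ} (h : u ≤ 0) : quarterStep u = 0 :=
  smoothTransition.zero_of_nonpos (by linarith)

theorem quarterStep_of_ge {u : ℝ} (h : 1 / 4 ≤ u) : quarterStep u = 1 :=
  smoothTransition.one_of_one_le (by linarith)

theorem quarterStep_eq_iff {u v : ℝ} (hv : v ∈ Set.Ioo (0 : ℝ) (1 / 4)) :
    quarterStep u = quarterStep v ↔ u = v := by
  refine ⟨fun h => ?_, fun h => h ▸ rfl⟩
  have hv0 : 0 < quarterStep v := smoothTransition.pos_of_pos (by linarith [hv.1])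
  have hv1 : quarterStep v < 1 := smoothTransition.lt_one_of_lt_one (by linarith [hv.2])
  have hu0 : 0 < u := by
    by_contra hu
    rw [quarterStep_of_nonpos (not_lt.1 hu)] at h; linarith
  have hu1 : u < 1 / 4 := by
    by_contra hu
    rw [quarterStep_of_ge (not_lt.1 hu)] at h; linarith
  have := smoothTransition_strictMonoOn.injOn (x₁ := 4 * u) (x₂ := 4 * v)
    ⟨by linarith, by linarith⟩ ⟨by linarith [hv.1], by linarith [hv.2]⟩ h
  linarith

theorem exists_quarterStep_eq {v : ℝ} (hv : v ∈ Set.Ioo (0 : ℝ) 1) :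
    ∃ u ∈ Set.Ioo (0 : ℝ) (1 / 4), quarterStep u = v := by
  obtain ⟨x, hx, h⟩ := exists_smoothTransition_eq hv
  refine ⟨x / 4, ⟨by linarith [hx.1], by linarith [hx.2]⟩, ?_⟩
  rw [quarterStep, mul_div_cancel₀ x (by norm_num), h]

theorem exists_hasDerivAt_quarterStep_pos {u : ℝ} (hu : u ∈ Set.Ioo (0 : ℝ) (1 / 4)) :
    ∃ d : ℝ, 0 < d ∧ HasDerivAt quarterStep d u := by
  obtain ⟨d, hd, h⟩ := exists_hasDerivAt_smoothTransition_pos (x := 4 * u)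
    (by linarith [hu.1]) (by linarith [hu.2])
  exact ⟨d * (4 * 1), by positivity, h.comp u ((hasDerivAt_id u).const_mul 4)⟩

theorem contDiff_wiggle (r : ℕ) (a : ℝ) : ContDiff ℝ ∞ (wiggle r a) :=
  (contDiff_const.sub (contDiff_cos.comp (contDiff_const.mul
    (contDiff_quarterStep.comp (contDiff_id.sub contDiff_const))))).div_const _

theorem wiggle_of_le {r : ℕ} {a u : ℝ} (h : u ≤ a) : wiggle r a u = 0 := by
  rw [wiggle, quarterStep_of_nonpos (by linarith)]; simp

theorem wiggle_of_ge {r : ℕ} {a u : ℝ} (h : a + 1 / 4 ≤ u) : wiggle r a u = 0 := by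
  rw [wiggle, quarterStep_of_ge (by linarith), mul_one, mul_comm, cos_nat_mul_two_pi]
  simp

theorem wiggle_nonneg (r : ℕ) (a u : ℝ) : 0 ≤ wiggle r a u := by
  rw [wiggle]; linarith [cos_le_one (2 * π * r * quarterStep (u - a))]

theorem wiggle_le_one (r : ℕ) (a u : ℝ) : wiggle r a u ≤ 1 := by
  rw [wiggle]; linarith [neg_one_le_cos (2 * π * r * quarterStep (u - a))]

theorem contDiff_sheetHeight (K r : ℕ) (a : ℝ) : ContDiff ℝ ∞ (sheetHeight K r a) := by
  have hs : ∀ c : ℝ, ContDiff ℝ ∞ fun y => quarterStep (y - c) := fun c =>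
    contDiff_quarterStep.comp (contDiff_id.sub contDiff_const)
  have hsum : ContDiff ℝ ∞ fun y : ℝ => ∑ i ∈ Finset.range K, quarterStep (y - i) :=
    ContDiff.sum fun i _ => hs i
  have hw : ContDiff ℝ ∞ fun y : ℝ => wiggle r a (y - K) :=
    (contDiff_wiggle r a).comp (contDiff_id.sub contDiff_const)
  exact ((hsum.sub (contDiff_const.mul (hs K))).add hw).sub (contDiff_wiggle r a)

/-- A smooth staircase: at i + u the steps below i are complete, those above i have not begun, and
only step i, if present, is in progress. -/
theorem sum_quarterStep (K i : ℕ) {u : ℝ} (hu : u ∈ Set.Ico (0 : ℝ) 1) :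
    ∑ j ∈ Finset.range K, quarterStep (i + u - j) = if i < K then i + quarterStep u else K := by
  induction K with
  | zero => simp
  | succ K ih =>
    rw [Finset.sum_range_succ, ih]
    rcases lt_trichotomy i K with h | h | h
    · have : (i : ℝ) + 1 ≤ K := by exact_mod_cast h
      rw [if_pos h, if_pos (by lia), quarterStep_of_nonpos (u := i + u - K) (by linarith [hu.2]),
        add_zero]
    · subst h
      rw [if_neg (lt_irrefl _), if_pos (by lia), add_sub_cancel_left]
    · have : (K : ℝ) + 1 ≤ i := by exact_mod_cast h
      rw [if_neg (by lia), if_neg (by lia), quarterStep_of_ge (u := i + u - K) (by linarith [hu.1])]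
      push_cast; ring

theorem sheetHeight_lower {K r i : ℕ} {a u : ℝ} (ha : 1 / 4 ≤ a) (ha' : a ≤ 1 / 2) (hi : i < K)
    (hu : u ∈ Set.Ico (0 : ℝ) 1) :
    sheetHeight K r a (i + u) = i + quarterStep u - if i = 0 then wiggle r a u else 0 := by
  have h : (i : ℝ) + 1 ≤ K := by exact_mod_cast hi
  have hneg : (i : ℝ) + u - K ≤ 0 := by linarith [hu.2]
  rw [sheetHeight, sum_quarterStep K i hu, if_pos hi, quarterStep_of_nonpos hneg,
    wiggle_of_le (hneg.trans (by linarith))]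
  split_ifs with h0
  · simp [h0]
  · have : (1 : ℝ) ≤ i := by exact_mod_cast Nat.one_le_iff_ne_zero.2 h0
    rw [wiggle_of_ge (u := i + u) (by linarith [hu.1])]; ring

theorem sheetHeight_top {K r : ℕ} {a u : ℝ} (ha' : a ≤ 1 / 2) (hK : 0 < K)
    (hu : u ∈ Set.Ico (0 : ℝ) 1) :
    sheetHeight K r a (K + u) = K - K * quarterStep u + wiggle r a u := by
  have : (1 : ℝ) ≤ K := by exact_mod_cast hK
  rw [sheetHeight, sum_quarterStep K K hu, if_neg (lt_irrefl _), add_sub_cancel_left,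
    wiggle_of_ge (u := K + u) (by linarith [hu.1])]
  ring

theorem sheetHeight_of_nonpos {K r : ℕ} {a y : ℝ} (ha : 1 / 4 ≤ a) (hy : y ≤ 0) :
    sheetHeight K r a y = 0 := by
  have hK : (0 : ℝ) ≤ K := K.cast_nonneg
  rw [sheetHeight, Finset.sum_eq_zero, quarterStep_of_nonpos, wiggle_of_le, wiggle_of_le]
  · ring
  · linarith
  · linarith
  · linarith
  · intro i _
    have : (0 : ℝ) ≤ i := i.cast_nonneg
    exact quarterStep_of_nonpos (by linarith)

theorem sheetHeight_of_ge {K r : ℕ} {a y : ℝ} (ha' : a ≤ 1 / 2)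
    (hy : K + 3 / 4 ≤ y) : sheetHeight K r a y = 0 := by
  have hK : (0 : ℝ) ≤ K := K.cast_nonneg
  have h1 : ∀ i ∈ Finset.range K, quarterStep (y - i) = 1 := fun i hi => by
    have : (i : ℝ) ≤ K := by exact_mod_cast (Finset.mem_range.1 hi).le
    exact quarterStep_of_ge (by linarith)
  rw [sheetHeight, Finset.sum_congr rfl h1, quarterStep_of_ge, wiggle_of_ge, wiggle_of_ge]
  · simp
  · linarith
  · linarith
  · linarith

/-- Before 1/4 the wiggles are off, and i + q = K - K q gives the stated value of q. Afterwards
sheet i has height i + 1, less the wiggle w if i = 0, and the top sheet has height w ≤ 1; so only i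
= 0 is possible, with w = 1/2. -/
theorem sheetHeight_lower_eq_top_iff {K r i : ℕ} {a u : ℝ} (ha : 1 / 4 ≤ a) (ha' : a ≤ 1 / 2)
    (hi : i < K) (hu : u ∈ Set.Ico (0 : ℝ) 1) :
    sheetHeight K r a (i + u) = sheetHeight K r a (K + u) ↔
      (u < 1 / 4 ∧ quarterStep u = (K - i) / (K + 1)) ∨
        (1 / 4 ≤ u ∧ i = 0 ∧ cos (2 * π * r * quarterStep (u - a)) = 0) := by
  rw [sheetHeight_lower ha ha' hi hu, sheetHeight_top ha' (by lia) hu]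
  rcases lt_or_ge u (1 / 4) with h | h
  · rw [wiggle_of_le (by linarith), eq_div_iff (by positivity)]
    simp only [ite_self, h, true_and, not_le.2 h, false_and, or_false]
    constructor <;> intro h' <;> linarith
  · rw [quarterStep_of_ge h]
    simp only [h, true_and, not_lt.2 h, false_and, false_or]
    rcases Nat.eq_zero_or_pos i with rfl | h0
    · simp only [if_true, wiggle, true_and, Nat.cast_zero]
      constructor <;> intro h' <;> linarith
    · have : (1 : ℝ) ≤ i := by exact_mod_cast h0
      simp only [h0.ne', if_false, false_and, iff_false]
      intro h'
      linarith [wiggle_le_one r a u]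

theorem exists_nat_add_of_mem_Ico {K : ℕ} {x : ℝ} (hx : x ∈ Set.Ico (0 : ℝ) (K + 1 : ℕ)) :
    ∃ i : ℕ, i ≤ K ∧ ∃ u ∈ Set.Ico (0 : ℝ) 1, x = i + u := by
  refine ⟨⌊x⌋₊, ?_, x - ⌊x⌋₊, ⟨?_, ?_⟩, by ring⟩
  · have := (Nat.floor_lt hx.1).2 hx.2
    lia
  · linarith [Nat.floor_le hx.1]
  · linarith [Nat.lt_floor_add_one x]

/-- For `K ≥ 1`, any `r` and `1/4 ≤ a ≤ 1/2` there is a function on the `(K + 1)`-fold cover of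
`ℝ / ℤ` with `K` double points over `(0, 1/4)` and `2 r` double points over `(a, a + 1/4)`, all of
which are transverse. -/
theorem exists_sheets {K : ℕ} (hK : 0 < K) (r : ℕ) {a : ℝ} (ha : 1 / 4 ≤ a) (ha' : a ≤ 1 / 2) :
    ∃ (M : ℝ → ℝ) (low : Fin K ⊕ Fin (2 * r) → ℕ) (u : Fin K ⊕ Fin (2 * r) → ℝ),
      ContDiff ℝ ∞ M ∧ Function.Periodic M (K + 1 : ℕ) ∧ Function.Injective u ∧
      (∀ p, low p < K) ∧ (∀ i, u (.inl i) ∈ Set.Ioo (0 : ℝ) (1 / 4)) ∧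
      (∀ l, u (.inr l) ∈ Set.Ioo a (a + 1 / 4)) ∧ (∀ p, M (K + u p) = M (low p + u p)) ∧
      (∀ p, deriv M (K + u p) ≠ deriv M (low p + u p)) ∧
      ∀ x ∈ Set.Ico (0 : ℝ) (K + 1 : ℕ), ∀ y ∈ Set.Ico (0 : ℝ) (K + 1 : ℕ), x ≠ y →
        (∃ j : ℤ, x = y + j) → M x = M y →
        ∃ p, (x = K + u p ∧ y = low p + u p) ∨ (x = low p + u p ∧ y = K + u p) := by
  set F := sheetHeight K r a with hFdef
  have hF : ContDiff ℝ ∞ F := contDiff_sheetHeight K r a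
  -- Beyond K + 3/4 all steps and wiggles are over, because a + 1/4 ≤ 3/4.
  obtain ⟨M, hM, hMp, hMF, hMd⟩ := exists_periodic_extension hF (b := K + 3 / 4)
    (T := (K + 1 : ℕ)) (by positivity) (by push_cast; linarith)
    (fun y => sheetHeight_of_nonpos ha) (fun y => sheetHeight_of_ge ha')
  have hleft : ∀ i : Fin K, ∃ u ∈ Set.Ioo (0 : ℝ) (1 / 4),
      quarterStep u = (K - (i : ℕ)) / (K + 1) := fun i => by
    have h1 : ((i : ℕ) : ℝ) < K := by exact_mod_cast i.2
    have h2 : (0 : ℝ) ≤ (i : ℕ) := Nat.cast_nonneg _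
    exact exists_quarterStep_eq ⟨div_pos (by linarith) (by linarith),
      (div_lt_one (by linarith)).2 (by linarith)⟩
  -- These values solve 2π r q = π/2 + l π, the zeros of the cosine in the wiggle.
  have hright : ∀ l : Fin (2 * r), ∃ v ∈ Set.Ioo (0 : ℝ) (1 / 4),
      quarterStep v = (2 * (l : ℕ) + 1) / (4 * r) := fun l => by
    have h1 : ((l : ℕ) : ℝ) + 1 ≤ 2 * r := by exact_mod_cast l.2
    have h2 : (0 : ℝ) ≤ (l : ℕ) := Nat.cast_nonneg _
    exact exists_quarterStep_eq ⟨div_pos (by linarith) (by linarith),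
      (div_lt_one (by linarith)).2 (by linarith)⟩
  choose α hα hαs using hleft
  choose β hβ hβs using hright
  let u : Fin K ⊕ Fin (2 * r) → ℝ := Sum.elim α fun l => a + β l
  let low : Fin K ⊕ Fin (2 * r) → ℕ := Sum.elim (fun i => i) fun _ => 0
  have hu : ∀ p, u p ∈ Set.Ioo (0 : ℝ) 1 := by
    rintro (i | l)
    · exact ⟨(hα i).1, (hα i).2.trans (by norm_num)⟩
    · exact ⟨by simp only [u, Sum.elim_inr]; linarith [(hβ l).1],
        by simp only [u, Sum.elim_inr]; linarith [(hβ l).2]⟩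
  have hu' : ∀ p, u p ∈ Set.Ico (0 : ℝ) 1 := fun p => Set.Ioo_subset_Ico_self (hu p)
  have hlow : ∀ p, low p < K := by
    rintro (i | l)
    · exact i.2
    · exact hK
  have hlowr : ∀ p, ((low p : ℕ) : ℝ) + 1 ≤ K := fun p => by exact_mod_cast hlow p
  have mtop : ∀ p, K + u p ∈ Set.Ico (0 : ℝ) (K + 1 : ℕ) := fun p =>
    ⟨by linarith [(hu p).1], by push_cast; linarith [(hu p).2]⟩
  have mlow : ∀ p, low p + u p ∈ Set.Ico (0 : ℝ) (K + 1 : ℕ) := fun p =>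
    ⟨add_nonneg (Nat.cast_nonneg _) (hu p).1.le, by push_cast; linarith [(hu p).2, hlowr p]⟩
  have hcoszero : ∀ l : Fin (2 * r), cos (2 * π * r * quarterStep (β l)) = 0 := fun l => by
    have hr0 : (r : ℝ) ≠ 0 := by
      have := l.2
      exact_mod_cast (by lia : r ≠ 0)
    rw [hβs, cos_eq_zero_iff]
    exact ⟨(l : ℕ), by push_cast; field_simp; ring⟩
  have hcross : ∀ p, F (low p + u p) = F (K + u p) := fun p => by
    rw [hFdef, sheetHeight_lower_eq_top_iff ha ha' (hlow p) (hu' p)]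
    rcases p with i | l
    · exact Or.inl ⟨(hα i).2, hαs i⟩
    · refine Or.inr ⟨?_, rfl, ?_⟩
      · simp only [u, Sum.elim_inr]; linarith [(hβ l).1]
      · simpa only [u, Sum.elim_inr, add_sub_cancel_left] using hcoszero l
  have hderiv : ∀ p, deriv F (K + u p) ≠ deriv F (low p + u p) := fun p => by
    have h1 : HasDerivAt (fun v => F (K + v) - F (low p + v))
        (deriv F (K + u p) - deriv F (low p + u p)) (u p) :=
      ((hF.hasDerivAt_deriv _).comp_const_add _ _).sub
        ((hF.hasDerivAt_deriv _).comp_const_add _ _)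
    rw [← sub_ne_zero]
    rcases p with i | l
    · obtain ⟨d, hd, hd'⟩ := exists_hasDerivAt_quarterStep_pos (hα i)
      have h2 : (fun v => F (K + v) - F (low (.inl i) + v)) =ᶠ[𝓝 (u (.inl i))]
          fun v => (K - (i : ℕ)) - (K + 1) * quarterStep v := by
        filter_upwards [Ioo_mem_nhds (hα i).1 (hα i).2] with v hv
        have hv1 : v ∈ Set.Ico (0 : ℝ) 1 := ⟨hv.1.le, hv.2.trans (by norm_num)⟩
        rw [hFdef, sheetHeight_lower ha ha' (hlow _) hv1, sheetHeight_top ha' hK hv1,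
          wiggle_of_le (by linarith [hv.2]), ite_self]
        simp only [low, Sum.elim_inl]
        ring
      have h3 := (hd'.const_mul ((K : ℝ) + 1)).const_sub ((K : ℝ) - (i : ℕ))
      rw [h1.unique (h3.congr_of_eventuallyEq h2)]
      exact neg_ne_zero.2 (by positivity)
    · obtain ⟨d, hd, hd'⟩ := exists_hasDerivAt_quarterStep_pos (hβ l)
      have h2 : (fun v => F (K + v) - F (low (.inr l) + v)) =ᶠ[𝓝 (u (.inr l))]
          fun v => -cos (2 * π * r * quarterStep (v - a)) := by
        have hl1 : a < u (.inr l) := by simp only [u, Sum.elim_inr]; linarith [(hβ l).1]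
        have hl2 : u (.inr l) < a + 1 / 4 := by simp only [u, Sum.elim_inr]; linarith [(hβ l).2]
        filter_upwards [Ioo_mem_nhds hl1 hl2] with v hv
        have hv1 : v ∈ Set.Ico (0 : ℝ) 1 := ⟨by linarith [hv.1], by linarith [hv.2]⟩
        rw [hFdef, sheetHeight_lower ha ha' (hlow _) hv1, sheetHeight_top ha' hK hv1,
          quarterStep_of_ge (by linarith [hv.1])]
        simp only [low, Sum.elim_inr, if_true, wiggle, Nat.cast_zero]
        ring
      have h3 : HasDerivAt (fun v => -cos (2 * π * r * quarterStep (v - a)))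
          (-(-sin (2 * π * r * quarterStep (u (.inr l) - a)) * (2 * π * r * d)))
          (u (.inr l)) := by
        have h4 : HasDerivAt quarterStep d (u (.inr l) - a) := by
          simpa only [u, Sum.elim_inr, add_sub_cancel_left] using hd'
        exact ((h4.comp_sub_const _ a).const_mul (2 * π * r)).cos.neg
      rw [h1.unique (h3.congr_of_eventuallyEq h2)]
      have hr0 : (r : ℝ) ≠ 0 := by
        have := l.2
        exact_mod_cast (by lia : r ≠ 0)
      have hs : sin (2 * π * r * quarterStep (u (.inr l) - a)) ≠ 0 := fun hs => by
        have h5 := hcoszero l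
        simp only [u, Sum.elim_inr, add_sub_cancel_left] at hs
        have := sin_sq_add_cos_sq (2 * π * r * quarterStep (β l))
        rw [hs, h5] at this
        norm_num at this
      refine neg_ne_zero.2 (mul_ne_zero (neg_ne_zero.2 hs) ?_)
      have := pi_pos.ne'
      have := hd.ne'
      positivity
  have hcomplete : ∀ {i : ℕ} {v : ℝ}, i < K → v ∈ Set.Ico (0 : ℝ) 1 → F (i + v) = F (K + v) →
      ∃ p, low p = i ∧ u p = v := fun {i v} hi hv h => by
    rw [hFdef, sheetHeight_lower_eq_top_iff ha ha' hi hv] at h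
    rcases h with ⟨-, h⟩ | ⟨-, rfl, h⟩
    · exact ⟨.inl ⟨i, hi⟩, rfl, ((quarterStep_eq_iff (hα ⟨i, hi⟩)).1 (h.trans (hαs ⟨i, hi⟩).symm)).symm⟩
    · obtain ⟨n, hn⟩ := cos_eq_zero_iff.1 h
      have hq0 : 0 ≤ quarterStep (v - a) := smoothTransition.nonneg _
      have hq1 : quarterStep (v - a) ≤ 1 := smoothTransition.le_one _
      have hn' : 4 * r * quarterStep (v - a) = 2 * n + 1 := by
        have := pi_pos.ne'
        field_simp at hn
        linarith
      have hr0 : (0 : ℝ) ≤ r := r.cast_nonneg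
      have n0 : 0 ≤ n := by
        have h3 : (0 : ℝ) ≤ 2 * n + 1 := by rw [← hn']; positivity
        have h4 : 0 ≤ 2 * n + 1 := by exact_mod_cast h3
        lia
      have n1 : n < 2 * r := by
        have h1 : (2 * n + 1 : ℝ) ≤ 4 * r := by
          rw [← hn']
          exact mul_le_of_le_one_right (by positivity) hq1
        have h2 : 2 * n + 1 ≤ 4 * r := by exact_mod_cast h1
        lia
      obtain ⟨l, rfl⟩ := Int.eq_ofNat_of_zero_le n0
      have hl : l < 2 * r := by exact_mod_cast n1
      refine ⟨.inr ⟨l, hl⟩, rfl, ?_⟩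
      have hr1 : (r : ℝ) ≠ 0 := by exact_mod_cast (by lia : r ≠ 0)
      have : v - a = β ⟨l, hl⟩ := (quarterStep_eq_iff (hβ _)).1 (by
        rw [hβs, eq_div_iff (by positivity)]
        push_cast at hn' ⊢
        linarith)
      simp only [u, Sum.elim_inr, ← this]
      ring
  refine ⟨M, low, u, hM, hMp, ?_, hlow, hα, fun l => ?_, fun p => ?_, fun p => ?_, ?_⟩
  · rintro (i | l) (j | l') h
    · have h' : α i = α j := h
      have := hαs i
      rw [h', hαs j, div_left_inj' (by positivity)] at this
      have h3 : ((j : ℕ) : ℝ) = (i : ℕ) := by linarith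
      exact congrArg _ (Fin.ext (by exact_mod_cast h3.symm))
    · have h' : α i = a + β l' := h
      linarith [(hα i).2, (hβ l').1]
    · have h' : a + β l = α j := h
      linarith [(hα j).2, (hβ l).1]
    · have h' : a + β l = a + β l' := h
      have hr0 : (r : ℝ) ≠ 0 := by
        have := l.2
        exact_mod_cast (by lia : r ≠ 0)
      have := hβs l
      rw [add_left_cancel h', hβs l', div_left_inj' (by positivity)] at this
      have h3 : ((l' : ℕ) : ℝ) = (l : ℕ) := by linarith
      exact congrArg _ (Fin.ext (by exact_mod_cast h3.symm))
  · exact ⟨by simp only [u, Sum.elim_inr]; linarith [(hβ l).1],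
      by simp only [u, Sum.elim_inr]; linarith [(hβ l).2]⟩
  · rw [hMF _ (mtop p), hMF _ (mlow p), hcross]
  · rw [hMd _ (mtop p), hMd _ (mlow p)]
    exact hderiv p
  · intro x hx y hy hxy hj hMxy
    rw [hMF x hx, hMF y hy] at hMxy
    obtain ⟨j, hj⟩ := hj
    obtain ⟨i, hi, v, hv, rfl⟩ := exists_nat_add_of_mem_Ico hx
    obtain ⟨i', hi', v', hv', rfl⟩ := exists_nat_add_of_mem_Ico hy
    have hvv : v = v' := by
      have h1 : v = v' + ((i' + j - i : ℤ) : ℝ) * 1 := by push_cast; linarith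
      exact eq_of_eq_add_int_mul hv hv' h1
    subst hvv
    have hne : i ≠ i' := fun h => hxy (by rw [h])
    -- Lower sheets rise in parallel at integer distance, and the wiggle only pushes sheet 0 further
    -- down, so they never meet.
    have hmid : ∀ {i i' : ℕ}, i < i' → i' < K → F (i + v) ≠ F (i' + v) := fun {i i'} h h' he => by
      rw [hFdef, sheetHeight_lower ha ha' (h.trans h') hv, sheetHeight_lower ha ha' h' hv,
        if_neg (show i' ≠ 0 by lia)] at he
      have h1 : (i : ℝ) + 1 ≤ i' := by exact_mod_cast h
      have h2 : 0 ≤ if i = 0 then wiggle r a v else 0 := by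
        split_ifs
        exacts [wiggle_nonneg r a v, le_rfl]
      linarith
    rcases hi.lt_or_eq with h | rfl
    · rcases hi'.lt_or_eq with h' | rfl
      · rcases lt_or_gt_of_ne hne with h'' | h''
        · exact (hmid h'' h' hMxy).elim
        · exact (hmid h'' h hMxy.symm).elim
      · obtain ⟨p, rfl, rfl⟩ := hcomplete h hv hMxy
        exact ⟨p, Or.inr ⟨rfl, rfl⟩⟩
    · obtain ⟨p, rfl, rfl⟩ := hcomplete (lt_of_le_of_ne hi' hne.symm) hv' hMxy.symm
      exact ⟨p, Or.inl ⟨rfl, rfl⟩⟩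

/-! ### Realization of the invariants -/

/-- Since sign f' = -sign sin (2πY), a crossing over u contributes sign sin (2πu): this is +1 for
the K crossings over (0, 1/4) and η for the 2r others. -/
theorem exists_framedHolonomicKnot {K : ℕ} (hK : 0 < K) (r : ℕ) {a : ℝ} (ha : 1 / 4 ≤ a)
    (ha' : a ≤ 1 / 2) {η : SignType} (hη : η ≠ 0)
    (hsin : ∀ u ∈ Set.Ioo a (a + 1 / 4), SignType.sign (sin (2 * π * u)) = η) :
    ∃ f : ℝ → ℝ, IsFramedHolonomicKnot f ∧
      whitneyIndex f = -(K + 1) ∧ HasSelfLinkingNumber f (K + 2 * r * η) := by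
  obtain ⟨M, low, u, hM, hMp, hu, hlow, huα, huβ, hMc, hMd, hMall⟩ := exists_sheets hK r ha ha'
  have hsin' : ∀ v ∈ Set.Ioo (0 : ℝ) (1 / 4), SignType.sign (sin (2 * π * v)) = 1 := fun v hv =>
    sign_pos (sin_pos_of_pos_of_lt_pi (mul_pos two_pi_pos hv.1) (by nlinarith [hv.2, pi_pos]))
  have hper : ∀ (i : ℕ) (v : ℝ), sin (2 * π * (i + v)) = sin (2 * π * v) := fun i v => by
    rw [show 2 * π * (i + v) = 2 * π * v + i * (2 * π) by ring, sin_add_nat_mul_two_pi]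
  have hsinp : ∀ p, sin (2 * π * u p) ≠ 0 := by
    rintro (i | l) <;> rw [← sign_ne_zero]
    · rw [hsin' _ (huα i)]; exact one_ne_zero
    · rw [hsin _ (huβ l)]; exact hη
  obtain ⟨f, Y, hf, hW, hYmem, hYsurj, hYinj, hYc, hYsign⟩ :=
    exists_framedHolonomicKnot_of_sheets K.succ_pos hM hMp fun x hx y hy hxy hj hMxy => by
      obtain ⟨p, ⟨rfl, rfl⟩ | ⟨rfl, rfl⟩⟩ := hMall x hx y hy hxy hj hMxy
      · exact ⟨hMd p, by rw [hper]; exact hsinp p⟩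
      · exact ⟨(hMd p).symm, by rw [hper]; exact hsinp p⟩
  have hu01 : ∀ p, u p ∈ Set.Ioo (0 : ℝ) 1 := by
    rintro (i | l)
    · exact ⟨(huα i).1, (huα i).2.trans (by norm_num)⟩
    · exact ⟨by linarith [(huβ l).1], by linarith [(huβ l).2]⟩
  have hlowr : ∀ p, ((low p : ℕ) : ℝ) + 1 ≤ K := fun p => by exact_mod_cast hlow p
  have htop : ∀ p, ∃ t ∈ Set.Ico 0 (2 * π), Y t = K + u p := fun p =>
    hYsurj _ ⟨add_nonneg (Nat.cast_nonneg _) (hu01 p).1.le, by push_cast; linarith [(hu01 p).2]⟩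
  have hbot : ∀ p, ∃ t ∈ Set.Ico 0 (2 * π), Y t = low p + u p := fun p =>
    hYsurj _ ⟨add_nonneg (Nat.cast_nonneg _) (hu01 p).1.le,
      by push_cast; linarith [(hu01 p).2, hlowr p]⟩
  choose s hs hYs using htop
  choose t ht hYt using hbot
  have hsignp : ∀ p, SignType.sign (deriv f (s p)) = -SignType.sign (sin (2 * π * u p)) :=
    fun p => by rw [hYsign, hYs, hper]
  have hS := hasSelfLinkingNumber_of_doublePoints hf s t hs ht (fun p q h => ?_) (fun p q h => ?_)
    (fun p => ?_) (fun x hx y hy hxy h => ?_) (fun p => ?_)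
  · refine ⟨f, hf, ?_, ?_⟩
    · rw [whitneyIndex_eq hW]; push_cast; rfl
    · convert hS using 1
      rw [finsum_eq_sum_of_fintype, Fintype.sum_sum_type]
      simp only [hsignp, hsin' _ (huα _), hsin _ (huβ _)]
      simp
  · have h1 := hYs p
    rw [h, hYt q] at h1
    linarith [hlowr q, (hu01 q).2, (hu01 p).1]
  · have h1 := hYs p
    rw [h, hYs q] at h1
    exact hu (add_left_cancel h1).symm
  · rw [hYc, hYs, hYt]
    exact ⟨hMc p, (K : ℤ) - low p, by push_cast; ring⟩
  · obtain ⟨h1, h2⟩ := (hYc x y).1 h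
    obtain ⟨p, ⟨e1, e2⟩ | ⟨e1, e2⟩⟩ :=
      hMall _ (hYmem x hx) _ (hYmem y hy) (hYinj.ne hxy) h2 h1
    · exact ⟨p, Or.inl ⟨hYinj (e1.trans (hYs p).symm), hYinj (e2.trans (hYt p).symm)⟩⟩
    · exact ⟨p, Or.inr ⟨hYinj (e1.trans (hYt p).symm), hYinj (e2.trans (hYs p).symm)⟩⟩
  · rw [← sign_ne_zero, hsignp, ← Left.sign_neg, sign_ne_zero, neg_ne_zero]
    exact hsinp p

theorem exists_framedHolonomicKnot_of_odd {m n : ℤ} (hm : m ≤ -2) (hmn : Odd (m + n)) :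
    ∃ f : ℝ → ℝ, IsFramedHolonomicKnot f ∧ whitneyIndex f = m ∧ HasSelfLinkingNumber f n := by
  obtain ⟨K, hK⟩ : ∃ K : ℕ, m = -(K + 1) := ⟨(-m - 1).toNat, by lia⟩
  obtain ⟨d, hd⟩ := hmn
  have hK0 : 0 < K := by lia
  -- The extra crossings go over (1/4, 1/2), where the sine is positive, to raise S above K, or over
  -- (1/2, 3/4), where it is negative, to lower it.
  rcases le_total (K : ℤ) n with h | h
  · obtain ⟨r, hr⟩ : ∃ r : ℕ, n = K + 2 * r := ⟨((n - K) / 2).toNat, by lia⟩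
    obtain ⟨f, hf, hW, hS⟩ := exists_framedHolonomicKnot hK0 r (a := 1 / 4) (η := 1) le_rfl
      (by norm_num) one_ne_zero fun u hu => sign_pos (sin_pos_of_pos_of_lt_pi
        (mul_pos two_pi_pos (by linarith [hu.1])) (by nlinarith [hu.2, pi_pos]))
    refine ⟨f, hf, hW.trans hK.symm, ?_⟩
    rw [hr]
    simpa using hS
  · obtain ⟨r, hr⟩ : ∃ r : ℕ, n = K + 2 * r * (-1) := ⟨((K - n) / 2).toNat, by lia⟩
    obtain ⟨f, hf, hW, hS⟩ := exists_framedHolonomicKnot hK0 r (a := 1 / 2) (η := -1)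
      (by norm_num) le_rfl (by decide) fun u hu => by
        refine sign_neg ?_
        rw [← neg_pos, ← sin_sub_pi]
        exact sin_pos_of_pos_of_lt_pi (by nlinarith [hu.1, pi_pos]) (by nlinarith [hu.2, pi_pos])
    refine ⟨f, hf, hW.trans hK.symm, ?_⟩
    rw [hr]
    simpa using hS

theorem proposition1p1 :
    (∀ f : ℝ → ℝ, IsFramedHolonomicKnot f →
      whitneyIndex f < 0 ∧
      (whitneyIndex f = -1 →
        HasSelfLinkingNumber f 0 ∧ IsUnknot (holonomicSpaceCurve f))) ∧
    (∀ m n : ℤ, m ≤ -2 → Odd (m + n) →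
      ∃ f : ℝ → ℝ, IsFramedHolonomicKnot f ∧
        whitneyIndex f = m ∧ HasSelfLinkingNumber f n) :=
  ⟨fun _ hf => ⟨hf.whitneyIndex_neg, hf.trivial_of_whitneyIndex_eq_neg_one⟩,
    fun _ _ hm hmn => exists_framedHolonomicKnot_of_odd hm hmn⟩
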